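/- Let $G=(V,E)$ be a finite directed multigraph (parallel edges and directed cycles are allowed) with a source $S$ and two terminals $T_1,T_2$, both different from $S$; every edge has unit capacity, i.e. carries one symbol per time slot. For a set $U\subseteq V\setminus\{S\}$ let $\text{min-cut}(S,U)$ be the minimum, over all $C\subseteq V$ with $S\in C$ and $C\cap U=\emptyset$, of the number of edges leaving $C$. The source has three independent, uniformly distributed messages $X_0,X_1,X_2$ of rates $H_0,H_1,H_2\ge 0$ (in symbols per time slot); $T_1$ wants $(X_0,X_1)$ and $T_2$ wants $(X_0,X_2)$. Consider the inequalities $$\text{min-cut}(S,T_1)\ge H_0+H_1,\quad \text{min-cut}(S,T_2)\ge H_0+H_2,\quad \text{min-cut}(S,\{T_1,T_2\})\ge H_0+H_1+H_2.\qquad(*)$$ (a) For all real $H_0,H_1,H_2\ge0$, the demands can be met if and only if $(*)$ holds. Here the demands can be met if for every $\delta>0$ there are $q\ge2$, $L\ge1$ and a (possibly nonlinear) causal code using the network for $L$ time slots, with one symbol of an alphabet of size $q$ per edge and slot, and with at least $q^{L(H_i-\delta)}$ possible values of $X_i$ for $i=0,1,2$, such that the probability that some terminal fails to decode what it wants is at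 most $\delta$. (b) If $H_0,H_1,H_2$ are non-negative integers and $(*)$ holds, then over some finite field of characteristic $2$ there is a linear network code (with unit delay on each edge, and source streams $X_i$ of $H_i$ field symbols per slot) from which $T_1$ recovers $X_0,X_1$ and $T_2$ recovers $X_0,X_2$ exactly, with bounded delay, and in which $X_1$ is routed on $H_1$ paths from $S$ to $T_1$ and $X_2$ is routed on $H_2$ paths from $S$ to $T_2$; these $H_1+H_2$ paths are pairwise edge-disjoint, each carries one stream that is only forwarded, and every other edge carries linear combinations of $X_0$ only. Conversely, if a linear network code over a finite field lets $T_1$ recover $X_0,X_1$ and $T_2$ recover $X_0,X_2$ exactly with bounded delay, then $(*)$ holds. (c) If $H_0,H_1,H_2\ge0$ are real and $(*)$ holds, then for every integer $n\ge1$ there is a solution as in (b), with $\lfloor nH_0\rfloor,\lfloor nH_1\rfloor,\lfloor nH_2\rfloor$ streams, in the network obtained from $G$ by replacing each edge by $n$ parallel edges of unit capacity (a time unit that is $n$ times as long). -/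

import Mathlib

/-- A directed multigraph with vertex type `V` and edge type `E` (parallel edges, loops and directed
cycles are allowed), with a source `S` and two terminals `T1`, `T2`. Each edge has unit capacity:
it carries one symbol per time slot. -/
structure Network (V E : Type*) where
  src : E → V
  tgt : E → V
  S : V
  T1 : V
  T2 : V

namespace Network

variable {V E : Type*}

/-! ### Cuts -/

open Classical in
/-- Capacity of the cut `(C, Cᶜ)`: the number of edges leaving `C`. -/
noncomputable def cutCapacity [Fintype E] (N : Network V E) (C : Set V) : ℕ :=
  (Finset.univ.filter fun e : E => N.src e ∈ C ∧ N.tgt e ∉ C).card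

/-- The minimum cut between the source and a set `U` of vertices (which does not contain the
source). -/
noncomputable def minCut [Fintype E] (N : Network V E) (U : Set V) : ℕ :=
  sInf {k | ∃ C : Set V, N.S ∈ C ∧ Disjoint U C ∧ k = N.cutCapacity C}

/-- The three min-cut inequalities. -/
def CutBounds [Fintype E] (N : Network V E) (H0 H1 H2 : ℝ) : Prop :=
  H0 + H1 ≤ (N.minCut {N.T1} : ℝ) ∧
  H0 + H2 ≤ (N.minCut {N.T2} : ℝ) ∧
  H0 + H1 + H2 ≤ (N.minCut {N.T1, N.T2} : ℝ)

/-! ### Arbitrary codes -/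

/-- An arbitrary (not necessarily linear) code that uses the network during `L` time slots, where
each edge carries one symbol of an alphabet of size `q` in each slot, for messages
`X0`, `X1`, `X2` with `m0`, `m1`, `m2` possible values. The symbol sent on an edge that leaves a
vertex other than the source is a function of what this vertex received in earlier slots; an
edge leaving the source may depend on all three messages. -/
structure BlockCode (N : Network V E) (q L m0 m1 m2 : ℕ) where
  sym : Fin m0 × Fin m1 × Fin m2 → E → Fin L → Fin q
  causal : ∀ e, N.src e ≠ N.S → ∀ t w w',
    (∀ e', N.tgt e' = N.src e → ∀ s < t, sym w e' s = sym w' e' s) → sym w e t = sym w' e t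
  dec1 : ({e // N.tgt e = N.T1} → Fin L → Fin q) → Fin m0 × Fin m1
  dec2 : ({e // N.tgt e = N.T2} → Fin L → Fin q) → Fin m0 × Fin m2

/-- Both terminals decode what they want when the messages are `w`. -/
def BlockCode.Correct {N : Network V E} {q L m0 m1 m2 : ℕ} (c : N.BlockCode q L m0 m1 m2)
    (w : Fin m0 × Fin m1 × Fin m2) : Prop :=
  c.dec1 (fun e => c.sym w e.1) = (w.1, w.2.1) ∧ c.dec2 (fun e => c.sym w e.1) = (w.1, w.2.2)

open Classical in
/-- The probability of error for independent and uniformly distributed messages. -/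
noncomputable def BlockCode.errorProb {N : Network V E} {q L m0 m1 m2 : ℕ}
    (c : N.BlockCode q L m0 m1 m2) : ℝ :=
  ((Finset.univ.filter fun w => ¬ c.Correct w).card : ℝ) / ((m0 : ℝ) * m1 * m2)

/-- The demands can be met at rates `H0`, `H1`, `H2` (in symbols per time slot, so that the capacity
of an edge is `1`): up to an arbitrarily small loss in the rates there are codes with arbitrarily
small probability of error. -/
def Achievable (N : Network V E) (H0 H1 H2 : ℝ) : Prop :=
  ∀ δ : ℝ, 0 < δ → ∃ q L m0 m1 m2 : ℕ, 2 ≤ q ∧ 1 ≤ L ∧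
    (q : ℝ) ^ ((L : ℝ) * (H0 - δ)) ≤ m0 ∧
    (q : ℝ) ^ ((L : ℝ) * (H1 - δ)) ≤ m1 ∧
    (q : ℝ) ^ ((L : ℝ) * (H2 - δ)) ≤ m2 ∧
    ∃ c : N.BlockCode q L m0 m1 m2, c.errorProb ≤ δ

/-! ### Linear network codes -/

/-- A linear network code over `F` for source streams indexed by `M`: `inj e m` is the coefficient
of the source stream `m` on the edge `e` (only for edges leaving the source), and `ker e e'` is
the coefficient of the incoming edge `e'` on the outgoing edge `e`. -/
structure LinearCode (N : Network V E) (F : Type*) [Field F] (M : Type*) where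
  inj : E → M → F
  ker : E → E → F
  inj_eq_zero : ∀ e m, N.src e ≠ N.S → inj e m = 0
  ker_eq_zero : ∀ e e', N.tgt e' ≠ N.src e → ker e e' = 0

namespace LinearCode

variable {N : Network V E} {F : Type*} [Field F] {M : Type*}

/-- `c.signal x t e` is the symbol on the edge `e` in slot `t` when the source symbols are `x m t`.
Passing an edge takes one time slot. -/
def signal [Fintype E] [Fintype M] (c : N.LinearCode F M) (x : M → ℕ → F) : ℕ → E → F
  | 0, _ => 0
  | t + 1, e => ∑ m, c.inj e m * x m t + ∑ e', c.ker e e' * c.signal x t e'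

/-- A terminal at `T` recovers the source stream `m` with delay `D`: for each `t`, the symbols
received up to slot `t + D` determine the source symbol of slot `t`. -/
def Decodes [Fintype E] [Fintype M] (c : N.LinearCode F M) (T : V) (D : ℕ) (m : M) : Prop :=
  ∀ (x x' : M → ℕ → F) (t : ℕ),
    (∀ e, N.tgt e = T → ∀ s ≤ t + D, c.signal x s e = c.signal x' s e) → x m t = x' m t

open Classical in
/-- The stream `m` is routed along the list `p` of edges: the first edge carries `m` itself, every
further edge forwards what its predecessor in `p` carries, and nothing is ever added to it. -/
def Routes (c : N.LinearCode F M) (m : M) (p : List E) : Prop :=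
  (∀ e, p.head? = some e →
    (∀ m', c.inj e m' = if m' = m then 1 else 0) ∧ ∀ e', c.ker e e' = 0) ∧
  (∀ e' e, [e', e] <:+: p →
    (∀ m', c.inj e m' = 0) ∧ ∀ e'', c.ker e e'' = if e'' = e' then 1 else 0)

end LinearCode

/-- The source streams: `h0` of them form `X0`, `h1` form `X1`, and `h2` form `X2`. -/
abbrev Streams (h0 h1 h2 : ℕ) : Type := Fin h0 ⊕ (Fin h1 ⊕ Fin h2)

/-- The code `c` meets the demands: `T1` recovers `X0` and `X1`, and `T2` recovers `X0` and `X2`,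
with some bounded delay. -/
def LinearCode.IsSolution {N : Network V E} {F : Type*} [Field F] [Fintype E] {h0 h1 h2 : ℕ}
    (c : N.LinearCode F (Streams h0 h1 h2)) : Prop :=
  ∃ D : ℕ,
    (∀ i, c.Decodes N.T1 D (Sum.inl i)) ∧ (∀ i, c.Decodes N.T1 D (Sum.inr (Sum.inl i))) ∧
    (∀ i, c.Decodes N.T2 D (Sum.inl i)) ∧ (∀ i, c.Decodes N.T2 D (Sum.inr (Sum.inr i)))

/-- `p` is the list of edges of a directed walk from `u` to `v`. -/
def IsWalk (N : Network V E) : V → V → List E → Prop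
  | u, v, [] => u = v
  | u, v, e :: p => N.src e = u ∧ N.IsWalk (N.tgt e) v p

/-- A walk that visits no vertex twice. -/
def IsPath (N : Network V E) (u v : V) (p : List E) : Prop :=
  N.IsWalk u v p ∧ (u :: p.map N.tgt).Nodup

/-- There is a linear solution over `F` in which `X1` and `X2` are routed along pairwise
edge-disjoint paths from the source to `T1` and to `T2`, one path for each stream, and in which all
other edges carry linear combinations of `X0` only: neither `X1`, `X2` nor the symbols of a routing
path are mixed into them. -/
def RoutedSolvable [Fintype E] (N : Network V E) (F : Type*) [Field F] (h0 h1 h2 : ℕ) : Prop :=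
  ∃ (c : N.LinearCode F (Streams h0 h1 h2)) (P : Fin h1 ⊕ Fin h2 → List E),
    c.IsSolution ∧
    (∀ i, N.IsPath N.S N.T1 (P (Sum.inl i))) ∧
    (∀ i, N.IsPath N.S N.T2 (P (Sum.inr i))) ∧
    (∀ i j, i ≠ j → List.Disjoint (P i) (P j)) ∧
    (∀ i, c.Routes (Sum.inr i) (P i)) ∧
    (∀ e, (∀ i, e ∉ P i) →
      (∀ i, c.inj e (Sum.inr i) = 0) ∧ ∀ i, ∀ e' ∈ P i, c.ker e e' = 0)

/-- The same network with a time unit that is `n` times as long: every edge is replaced by `n`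
parallel edges of unit capacity. -/
def scale (N : Network V E) (n : ℕ) : Network V (E × Fin n) where
  src e := N.src e.1
  tgt e := N.tgt e.1
  S := N.S
  T1 := N.T1
  T2 := N.T2

end Network

/-!
The heart of the proof is combinatorial (`exists_paths`): under the three cut inequalities there are
`h1` paths to `T1` and `h2` paths to `T2`, all edge-disjoint, whose removal leaves cuts of at least
`h0` edges to either terminal. Menger's theorem (`exists_disjoint_walks`) first gives edge-disjoint
walks, `h0 + h1` to `T1` and `h2` to `T2`. Remove the walks to `T1`; the cuts to `T2` are then still at
least `h2`. Put them back one at a time: as long as the minimum cut to `T2` is below its value in the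
whole network, some single walk raises it (`exists_few_walks`: any walk that meets the smallest
minimum cut set crosses every minimum cut). Hence `h0` of the walks bring the cuts to `T2` back to
`h0 + h2`, and `h1` of the others may be reserved for `X1`. The same argument with the terminals
exchanged then reserves `h2` walks for `X2` (`exists_reserved_walks`).

On the remaining edges `X0` is multicast by linear coding. With a unit delay on each edge the
signals are power series in the delay, also on networks with cycles, and a terminal recovers `X0` with
bounded delay as soon as a square transfer matrix has nonzero determinant
(`LinearCode.exists_decodes_of_det_ne_zero`). With indeterminate coefficients the determinants for
both terminals are nonzero, because routing along `h0` disjoint paths is a specialisation; a point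
where their product does not vanish exists over a finite field of characteristic `2`
(`exists_finite_field_transferDet_ne_zero`). Real rates follow by rounding down in `N.scale n`.

For the capacity region, a linear solution, run for a long time, is a block code without errors whose
rates tend to those of the solution (`LinearCode.IsSolution.achievable`), and the parallel
edges of `N.scale n` become one edge with a larger alphabet (`Achievable.of_scale`). Conversely, what
is received beyond a cut is a function of the symbols on the cut, so that counting correctly decoded
messages gives the cut inequalities (`Achievable.cutBounds`), for arbitrary codes and hence also for
linear solutions.
-/

/-! ### Edge-disjoint walks -/

namespace Network

variable {V E : Type*}

open Classical in
/-- The number of edges in `F` that enter the vertex set `X`. Cuts are written here from the side of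
the terminals: `X` is the complement of the source side. -/
noncomputable def inDeg (N : Network V E) (F : Finset E) (X : Set V) : ℕ :=
  (F.filter fun e => N.src e ∉ X ∧ N.tgt e ∈ X).card

theorem cutCapacity_eq_inDeg [Fintype E] (N : Network V E) (C : Set V) :
    N.cutCapacity C = N.inDeg Finset.univ Cᶜ := by
  classical
  simp [cutCapacity, inDeg]

theorem inDeg_mono (N : Network V E) {F F' : Finset E} (h : F ⊆ F') (X : Set V) :
    N.inDeg F X ≤ N.inDeg F' X :=
  by classical exact Finset.card_le_card (Finset.filter_subset_filter _ h)

theorem inDeg_lt_inDeg (N : Network V E) {F F' : Finset E} (h : F ⊆ F') {X : Set V} {e : E}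
    (heF' : e ∈ F') (heF : e ∉ F) (hs : N.src e ∉ X) (ht : N.tgt e ∈ X) :
    N.inDeg F X < N.inDeg F' X := by
  classical
  exact Finset.card_lt_card ((Finset.ssubset_iff_of_subset (Finset.filter_subset_filter _ h)).2
    ⟨e, by simp [*], by simp [*]⟩)

theorem inDeg_submodular (N : Network V E) (F : Finset E) (X Y : Set V) :
    N.inDeg F (X ∪ Y) + N.inDeg F (X ∩ Y) ≤ N.inDeg F X + N.inDeg F Y := by
  classical
  simp only [inDeg, Finset.card_filter, ← Finset.sum_add_distrib]
  refine Finset.sum_le_sum fun e _ => ?_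
  by_cases h1 : N.src e ∈ X <;> by_cases h2 : N.src e ∈ Y <;> by_cases h3 : N.tgt e ∈ X <;>
    by_cases h4 : N.tgt e ∈ Y <;> simp [h1, h2, h3, h4]

open Classical in
theorem inDeg_erase_add (N : Network V E) {F : Finset E} {e : E} (he : e ∈ F) (X : Set V) :
    N.inDeg (F.erase e) X + (if N.src e ∉ X ∧ N.tgt e ∈ X then 1 else 0) = N.inDeg F X := by
  simp only [inDeg, Finset.card_filter]
  exact Finset.sum_erase_add _ _ he

open Classical in
/-- The number of indices `i` whose target `τ i` lies in `X`. -/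
noncomputable def demand {ι : Type*} [Fintype ι] (τ : ι → V) (X : Set V) : ℕ :=
  (Finset.univ.filter fun i => τ i ∈ X).card

theorem demand_union_add_inter {ι : Type*} [Fintype ι] (τ : ι → V) (X Y : Set V) :
    demand τ (X ∪ Y) + demand τ (X ∩ Y) = demand τ X + demand τ Y := by
  classical
  simp only [demand, Finset.card_filter, ← Finset.sum_add_distrib]
  refine Finset.sum_congr rfl fun i _ => ?_
  by_cases h1 : τ i ∈ X <;> by_cases h2 : τ i ∈ Y <;> simp [h1, h2]

open Classical in
theorem demand_update {ι : Type*} [Fintype ι] (τ : ι → V) (i : ι) (u : V) (X : Set V) :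
    demand (Function.update τ i u) X + (if τ i ∈ X then 1 else 0) =
      demand τ X + (if u ∈ X then 1 else 0) := by
  simp only [demand, Finset.card_filter]
  rw [← Finset.sum_erase_add _ _ (Finset.mem_univ i),
    ← Finset.sum_erase_add (a := i) _ (fun j => if τ j ∈ X then 1 else 0) (Finset.mem_univ i)]
  have : ∑ x ∈ Finset.univ.erase i, (if Function.update τ i u x ∈ X then 1 else 0) =
      ∑ x ∈ Finset.univ.erase i, (if τ x ∈ X then 1 else 0) :=
    Finset.sum_congr rfl fun j hj => by
      rw [Function.update_of_ne (Finset.ne_of_mem_erase hj)]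
  rw [this, Function.update_self]
  omega

theorem IsWalk.append_singleton (N : Network V E) {u : V} {p : List E} {e : E}
    (h : N.IsWalk u (N.src e) p) : N.IsWalk u (N.tgt e) (p ++ [e]) := by
  induction p generalizing u with
  | nil => exact ⟨h.symm, rfl⟩
  | cons a p ih => exact ⟨h.1, ih h.2⟩

/-- A walk that starts outside `X` and has an edge ending in `X` has an edge entering `X`. -/
theorem IsWalk.exists_enter (N : Network V E) {X : Set V} {u v : V} {p : List E}
    (h : N.IsWalk u v p) (hu : u ∉ X) {e : E} (he : e ∈ p) (hX : N.tgt e ∈ X) :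
    ∃ e' ∈ p, N.src e' ∉ X ∧ N.tgt e' ∈ X := by
  induction p generalizing u with
  | nil => simp at he
  | cons a p ih =>
    by_cases ha : N.tgt a ∈ X
    · exact ⟨a, by simp, h.1 ▸ hu, ha⟩
    · obtain ⟨e', h1, h2⟩ := ih h.2 ha (by
        rcases List.mem_cons.1 he with rfl | he
        · exact absurd hX ha
        · exact he)
      exact ⟨e', List.mem_cons_of_mem _ h1, h2⟩

theorem IsWalk.exists_enter_of_target (N : Network V E) {X : Set V} {u v : V} {p : List E}
    (h : N.IsWalk u v p) (hu : u ∉ X) (hv : v ∈ X) :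
    ∃ e' ∈ p, N.src e' ∉ X ∧ N.tgt e' ∈ X := by
  induction p generalizing u with
  | nil => exact absurd (show u = v from h) (fun h' => hu (h' ▸ hv))
  | cons a p ih =>
    by_cases ha : N.tgt a ∈ X
    · exact ⟨a, by simp, h.1 ▸ hu, ha⟩
    · obtain ⟨e', h1, h2⟩ := ih h.2 ha
      exact ⟨e', List.mem_cons_of_mem _ h1, h2⟩

/-- **Menger's theorem** for edge-disjoint walks from the source to prescribed end vertices `τ i`.
The requirement `demand τ` is modular and `inDeg` is submodular, so tight sets are closed under
unions. Hence some edge `e` enters the end vertex of a given walk from outside the largest tight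
set that avoids this vertex; `e` becomes the last edge of that walk, and the remaining problem, with
the end vertex moved to the tail of `e`, still satisfies the cut condition. -/
theorem exists_disjoint_walks [Finite V] (N : Network V E) {ι : Type*} [Fintype ι]
    (F : Finset E) (τ : ι → V) (hF : ∀ X, N.S ∉ X → demand τ X ≤ N.inDeg F X) :
    ∃ P : ι → List E, (∀ i, N.IsWalk N.S (τ i) (P i)) ∧ (∀ i, ∀ e ∈ P i, e ∈ F) ∧
      ∀ i j, i ≠ j → List.Disjoint (P i) (P j) := by
  classical
  induction F using Finset.strongInduction generalizing τ with
  | H F ih =>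
  by_cases hS : ∀ i, τ i = N.S
  · exact ⟨fun _ => [], fun i => (hS i).symm, by simp, by simp⟩
  push Not at hS
  obtain ⟨i, hi⟩ := hS
  -- the largest tight set that avoids `τ i`
  obtain ⟨A, ⟨hAS, hAi, hAt⟩, hAmax⟩ := Set.Finite.exists_maximal
    (s := {X : Set V | N.S ∉ X ∧ τ i ∉ X ∧ N.inDeg F X = demand τ X}) (Set.toFinite _)
    ⟨∅, by simp [inDeg, demand]⟩
  have htight : ∀ X, N.S ∉ X → τ i ∉ X → N.inDeg F X = demand τ X → X ⊆ A := by
    intro X hXS hXi hX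
    have h1 := N.inDeg_submodular F A X
    have h2 := demand_union_add_inter τ A X
    have h3 := hF (A ∪ X) (by simp [*])
    have h4 := hF (A ∩ X) (by simp [*])
    exact Set.subset_union_right.trans
      (hAmax (y := A ∪ X) ⟨by simp [*], by simp [*], by omega⟩ Set.subset_union_left)
  obtain ⟨e, heF, hes, het⟩ : ∃ e ∈ F, N.src e ∉ A ∧ N.tgt e = τ i := by
    by_contra hcon
    push Not at hcon
    have h1 : N.inDeg F (insert (τ i) A) ≤ N.inDeg F A := by
      refine Finset.card_le_card fun e he => ?_
      simp only [Finset.mem_filter, Set.mem_insert_iff, not_or] at he ⊢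
      exact ⟨he.1, he.2.1.2, he.2.2.resolve_left (hcon e he.1 he.2.1.2)⟩
    have h2 : demand τ A < demand τ (insert (τ i) A) := by
      refine Finset.card_lt_card ((Finset.ssubset_iff_of_subset fun j hj => ?_).2
        ⟨i, by simp, by simp [hAi]⟩)
      simp only [Finset.mem_filter, Set.mem_insert_iff] at hj ⊢
      exact ⟨hj.1, Or.inr hj.2⟩
    have h3 := hF (insert (τ i) A) (by simp [hAS, Ne.symm hi])
    omega
  obtain ⟨P, hP1, hP2, hP3⟩ := ih (F.erase e) (Finset.erase_ssubset heF)
    (Function.update τ i (N.src e)) (by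
      intro X hX
      have h1 := N.inDeg_erase_add heF X
      have h2 := demand_update τ i (N.src e) X
      have h3 := hF X hX
      rw [het] at h1
      by_cases hu : N.src e ∈ X <;> by_cases hv : τ i ∈ X <;> simp [hu, hv] at h1 h2
      · omega
      · have : N.inDeg F X ≠ demand τ X := fun h => hes (htight X hX hv h hu)
        omega
      · omega
      · omega)
  refine ⟨Function.update P i (P i ++ [e]), fun j => ?_, fun j f hf => ?_, ?_⟩
  · rcases eq_or_ne j i with rfl | hj
    · have := hP1 j
      rw [Function.update_self] at this ⊢
      rw [← het]
      exact this.append_singleton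
    · simpa [hj] using hP1 j
  · rcases eq_or_ne j i with rfl | hj
    · rw [Function.update_self, List.mem_append, List.mem_singleton] at hf
      rcases hf with hf | rfl
      · exact Finset.mem_of_mem_erase (hP2 j f hf)
      · exact heF
    · rw [Function.update_of_ne hj] at hf
      exact Finset.mem_of_mem_erase (hP2 j f hf)
  · have he : ∀ j, e ∉ P j := fun j hj => by simpa using hP2 j e hj
    intro j k hjk
    rcases eq_or_ne j i with rfl | hj
    · rw [Function.update_self, Function.update_of_ne hjk.symm, List.disjoint_append_left]
      exact ⟨hP3 j k hjk, by simpa using he k⟩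
    · rcases eq_or_ne k i with rfl | hk
      · rw [Function.update_self, Function.update_of_ne hj, List.disjoint_append_right]
        exact ⟨hP3 j k hjk, by simpa using he j⟩
      · simpa [hj, hk] using hP3 j k hjk

/-- Every cut between the source and `T` has at least `k` edges in `F`. -/
def CutAtLeast (N : Network V E) (F : Finset E) (T : V) (k : ℕ) : Prop :=
  ∀ X : Set V, N.S ∉ X → T ∈ X → k ≤ N.inDeg F X

theorem CutAtLeast.mono {N : Network V E} {F F' : Finset E} {T : V} {k : ℕ}
    (h : N.CutAtLeast F T k) (hF : F ⊆ F') : N.CutAtLeast F' T k :=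
  fun X hX hT => (h X hX hT).trans (N.inDeg_mono hF X)

theorem CutAtLeast.exists_walks [Finite V] {N : Network V E} {F : Finset E} {T : V} {k : ℕ}
    (h : N.CutAtLeast F T k) :
    ∃ P : Fin k → List E, (∀ i, N.IsWalk N.S T (P i)) ∧ (∀ i, ∀ e ∈ P i, e ∈ F) ∧
      ∀ i j, i ≠ j → List.Disjoint (P i) (P j) := by
  refine N.exists_disjoint_walks F (fun _ => T) fun X hX => ?_
  by_cases hT : T ∈ X
  · simpa [demand, hT] using h X hX hT
  · simp [demand, hT]

theorem cutAtLeast_of_walks {N : Network V E} {F : Finset E} {T : V} {ι : Type*} [Fintype ι]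
    {P : ι → List E} {k : ℕ} (hk : Fintype.card ι = k) (hP : ∀ i, N.IsWalk N.S T (P i))
    (hPF : ∀ i, ∀ e ∈ P i, e ∈ F) (hd : ∀ i j, i ≠ j → List.Disjoint (P i) (P j)) :
    N.CutAtLeast F T k := by
  classical
  subst hk
  intro X hX hT
  choose f hf using fun i => (hP i).exists_enter_of_target N hX hT
  have hinj : Function.Injective f := fun i j hij => by
    by_contra hne
    exact hd i j hne (hf i).1 (hij ▸ (hf j).1)
  rw [← Finset.card_univ, ← Finset.card_image_of_injective _ hinj]
  refine Finset.card_le_card fun e he => ?_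
  obtain ⟨i, -, rfl⟩ := Finset.mem_image.1 he
  simpa using ⟨hPF i _ (hf i).1, (hf i).2⟩

/-- If adding all of the edge-disjoint walks `R i` to `H` raises the minimum cut to `T` from at
least `b` to at least `a + b`, then already `a` of these walks do. To gain one unit, add any walk
that meets the smallest minimum cut set `X`: it starts outside of every minimum cut set and meets
all of them, because they contain `X`. -/
theorem exists_few_walks [Finite V] [DecidableEq E] (N : Network V E) {ι : Type*} [Fintype ι]
    (H : Finset E) (T : V) (a b : ℕ) (R : ι → List E) (v : ι → V)
    (hR : ∀ i, N.IsWalk N.S (v i) (R i)) (hd : ∀ i j, i ≠ j → List.Disjoint (R i) (R j))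
    (hRH : ∀ i, ∀ e ∈ R i, e ∉ H) (hH : N.CutAtLeast H T b)
    (hall : N.CutAtLeast (H ∪ Finset.univ.biUnion fun i => (R i).toFinset) T (a + b)) :
    ∃ I : Finset ι, I.card ≤ a ∧
      N.CutAtLeast (H ∪ I.biUnion fun i => (R i).toFinset) T (a + b) := by
  classical
  suffices h : ∀ k ≤ a, ∃ I : Finset ι, I.card ≤ k ∧
      N.CutAtLeast (H ∪ I.biUnion fun i => (R i).toFinset) T (k + b) from h a le_rfl
  intro k
  induction k with
  | zero => exact fun _ => ⟨∅, by simp, by simpa using hH⟩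
  | succ k ih =>
    intro hk
    obtain ⟨I, hI, hcut⟩ := ih (by omega)
    set G := H ∪ I.biUnion fun i => (R i).toFinset with hG
    by_cases hdone : N.CutAtLeast G T (k + 1 + b)
    · exact ⟨I, by omega, hdone⟩
    obtain ⟨X₀, hX₀S, hX₀T, hX₀⟩ : ∃ X, N.S ∉ X ∧ T ∈ X ∧ N.inDeg G X = k + b := by
      simp only [CutAtLeast] at hdone
      push Not at hdone
      obtain ⟨X, h1, h2, h3⟩ := hdone
      have := hcut X h1 h2
      exact ⟨X, h1, h2, by omega⟩
    -- the smallest minimum cut set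
    obtain ⟨X, ⟨hXS, hXT, hXt⟩, hXmin⟩ := Set.Finite.exists_minimal
      (s := {X : Set V | N.S ∉ X ∧ T ∈ X ∧ N.inDeg G X = k + b}) (Set.toFinite _)
      ⟨X₀, hX₀S, hX₀T, hX₀⟩
    have hsub : ∀ Y, N.S ∉ Y → T ∈ Y → N.inDeg G Y = k + b → X ⊆ Y := by
      intro Y hYS hYT hY
      have h1 := N.inDeg_submodular G X Y
      have h3 := hcut (X ∪ Y) (by simp [*]) (by simp [*])
      have h4 := hcut (X ∩ Y) (by simp [*]) (by simp [*])
      exact (hXmin (y := X ∩ Y) ⟨by simp [*], by simp [*], by omega⟩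
        Set.inter_subset_left).trans Set.inter_subset_right
    obtain ⟨i, e, heR, heG, -, heX⟩ :
        ∃ i, ∃ e ∈ R i, e ∉ G ∧ N.src e ∉ X ∧ N.tgt e ∈ X := by
      by_contra hcon
      push Not at hcon
      have h1 := hall X hXS hXT
      have h2 : N.inDeg (H ∪ Finset.univ.biUnion fun i => (R i).toFinset) X ≤ N.inDeg G X := by
        refine Finset.card_le_card fun e he => ?_
        simp only [Finset.mem_filter, Finset.mem_union, Finset.mem_biUnion, Finset.mem_univ,
          true_and, List.mem_toFinset] at he ⊢
        refine ⟨?_, he.2⟩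
        rcases he.1 with h | ⟨i, hi⟩
        · exact Finset.mem_union_left _ h
        · by_contra hG'
          exact hcon i e hi hG' he.2.1 he.2.2
      omega
    have hiI : i ∉ I := fun hi => heG (by
      simp only [hG, Finset.mem_union, Finset.mem_biUnion, List.mem_toFinset]
      exact Or.inr ⟨i, hi, heR⟩)
    have hGsub : G ⊆ H ∪ (insert i I).biUnion fun i => (R i).toFinset := by
      rw [Finset.biUnion_insert]
      exact Finset.union_subset_union_right Finset.subset_union_right
    refine ⟨insert i I, by rw [Finset.card_insert_of_notMem hiI]; omega, fun Y hYS hYT => ?_⟩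
    have h1 := hcut Y hYS hYT
    have h2 := N.inDeg_mono hGsub Y
    by_cases hY : N.inDeg G Y = k + b
    · obtain ⟨f, hfR, hfs, hft⟩ := (hR i).exists_enter N hYS heR (hsub Y hYS hYT hY heX)
      have hfG : f ∉ G := by
        simp only [hG, Finset.mem_union, Finset.mem_biUnion, List.mem_toFinset, not_or, not_exists,
          not_and]
        exact ⟨hRH i f hfR, fun j hj hfj =>
          hd i j (fun h => hiI (h ▸ hj)) hfR hfj⟩
      have := N.inDeg_lt_inDeg hGsub (X := Y) (e := f)
        (by simp [hfR]) hfG hfs hft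
      omega
    · omega

/-- Among `a + h` edge-disjoint walks to `T`, some `h` can be reserved such that, without their
edges, the cuts to `T` keep at least `a` edges and those to `T'` at least `a + b`. -/
theorem exists_reserved_walks [Finite V] [DecidableEq E] (N : Network V E) (F : Finset E)
    (T T' : V) (a b h : ℕ) (R : Fin (a + h) → List E) (hR : ∀ i, N.IsWalk N.S T (R i))
    (hRF : ∀ i, ∀ e ∈ R i, e ∈ F) (hd : ∀ i j, i ≠ j → List.Disjoint (R i) (R j))
    (hF : N.CutAtLeast F T' (a + b))
    (hFR : N.CutAtLeast (F \ Finset.univ.biUnion fun i => (R i).toFinset) T' b) :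
    ∃ P : Fin h → List E, (∀ i, N.IsWalk N.S T (P i)) ∧ (∀ i, ∀ e ∈ P i, e ∈ F) ∧
      (∀ i j, i ≠ j → List.Disjoint (P i) (P j)) ∧
      N.CutAtLeast (F \ Finset.univ.biUnion fun i => (P i).toFinset) T a ∧
      N.CutAtLeast (F \ Finset.univ.biUnion fun i => (P i).toFinset) T' (a + b) := by
  classical
  obtain ⟨I, hI, hcut⟩ := N.exists_few_walks (F \ Finset.univ.biUnion fun i => (R i).toFinset) T' a b
    R (fun _ => T) hR hd (fun i e he => by
      simp only [Finset.mem_sdiff, Finset.mem_biUnion, Finset.mem_univ, true_and,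
        List.mem_toFinset, not_and, not_not]
      exact fun _ => ⟨i, he⟩) hFR (hF.mono (by
        intro e he
        by_cases h : e ∈ Finset.univ.biUnion fun i => (R i).toFinset
        · exact Finset.mem_union_right _ h
        · exact Finset.mem_union_left _ (Finset.mem_sdiff.2 ⟨he, h⟩)))
  -- the reserved walks are `h` walks outside of `I`
  obtain ⟨J, hJI, hJ⟩ := Finset.exists_subset_card_eq (s := Iᶜ) (n := h) (by
    rw [Finset.card_compl, Fintype.card_fin]; omega)
  set f : Fin h ≃ J := (finCongr hJ.symm).trans J.equivFin.symm with hf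
  have hmem : ∀ {e}, e ∈ (Finset.univ.biUnion fun i => (R (f i)).toFinset) →
      ∃ j ∈ J, e ∈ R j := by
    intro e he
    simp only [Finset.mem_biUnion, Finset.mem_univ, true_and, List.mem_toFinset] at he
    obtain ⟨i, hi⟩ := he
    exact ⟨f i, (f i).2, hi⟩
  refine ⟨fun i => R (f i), fun i => hR _, fun i => hRF _,
    fun i j hij => hd _ _ fun h => hij (f.injective (Subtype.ext h)), ?_, ?_⟩
  · have hcard : Fintype.card {i // i ∉ J} = a := by
      rw [Fintype.card_subtype_compl, Fintype.card_fin, Fintype.card_coe, hJ]; omega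
    refine cutAtLeast_of_walks hcard (P := fun i : {i // i ∉ J} => R i) (fun i => hR _)
      (fun i e he => ?_) (fun i j hij => hd _ _ fun h => hij (Subtype.ext h))
    refine Finset.mem_sdiff.2 ⟨hRF _ e he, fun h => ?_⟩
    obtain ⟨j, hj, hej⟩ := hmem h
    exact hd i j (fun h => i.2 (h ▸ hj)) he hej
  · refine hcut.mono fun e he => ?_
    rw [Finset.mem_union] at he
    rcases he with he | he
    · refine Finset.mem_sdiff.2 ⟨(Finset.mem_sdiff.1 he).1, fun h => (Finset.mem_sdiff.1 he).2 ?_⟩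
      obtain ⟨j, hj, hej⟩ := hmem h
      simp only [Finset.mem_biUnion, Finset.mem_univ, true_and, List.mem_toFinset]
      exact ⟨j, hej⟩
    · simp only [Finset.mem_biUnion, List.mem_toFinset] at he
      obtain ⟨i, hi, hei⟩ := he
      refine Finset.mem_sdiff.2 ⟨hRF _ e hei, fun h => ?_⟩
      obtain ⟨j, hj, hej⟩ := hmem h
      refine hd i j (fun h => ?_) hei hej
      have := Finset.mem_compl.1 (hJI hj)
      exact this (h ▸ hi)

theorem IsPath.exists_suffix {N : Network V E} {u v w : V} {p : List E} (h : N.IsPath u v p)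
    (hw : w ∈ u :: p.map N.tgt) : ∃ p' : List E, p' ⊆ p ∧ N.IsPath w v p' := by
  induction p generalizing u with
  | nil =>
    obtain rfl : w = u := by simpa using hw
    exact ⟨[], by simp, h⟩
  | cons a p ih =>
    rcases List.mem_cons.1 hw with rfl | hw
    · exact ⟨a :: p, by simp, h⟩
    · obtain ⟨p', h1, h2⟩ := ih (u := N.tgt a) ⟨h.1.2, (List.nodup_cons.1 h.2).2⟩ hw
      exact ⟨p', List.Subset.trans h1 (List.subset_cons_self _ _), h2⟩

theorem IsWalk.exists_isPath {N : Network V E} {u v : V} {p : List E} (h : N.IsWalk u v p) :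
    ∃ p' : List E, p' ⊆ p ∧ N.IsPath u v p' := by
  induction p generalizing u with
  | nil => exact ⟨[], by simp, h, by simp⟩
  | cons a p ih =>
    obtain ⟨p', h1, h2⟩ := ih h.2
    by_cases hu : u ∈ N.tgt a :: p'.map N.tgt
    · obtain ⟨p'', h3, h4⟩ := h2.exists_suffix hu
      exact ⟨p'', List.Subset.trans (List.Subset.trans h3 h1) (List.subset_cons_self _ _), h4⟩
    · exact ⟨a :: p', List.cons_subset_cons _ h1, ⟨h.1, h2.1⟩, List.nodup_cons.2 ⟨hu, h2.2⟩⟩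

/-- The combinatorial core: the cut inequalities give `h1` paths to `T1` and `h2` paths to `T2`, all
edge-disjoint, such that the other edges still contain `h0` edge-disjoint paths to `T1` and `h0`
edge-disjoint paths to `T2` (a path to `T1` and one to `T2` may share edges). -/
theorem exists_paths [Finite V] [Fintype E] (N : Network V E) {h0 h1 h2 : ℕ}
    (hc1 : N.CutAtLeast Finset.univ N.T1 (h0 + h1)) (hc2 : N.CutAtLeast Finset.univ N.T2 (h0 + h2))
    (hc12 : ∀ X, N.S ∉ X → N.T1 ∈ X → N.T2 ∈ X → h0 + h1 + h2 ≤ N.inDeg Finset.univ X) :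
    ∃ (P : Fin h1 ⊕ Fin h2 → List E) (Q1 Q2 : Fin h0 → List E),
      (∀ i, N.IsPath N.S N.T1 (P (Sum.inl i))) ∧ (∀ i, N.IsPath N.S N.T2 (P (Sum.inr i))) ∧
      (∀ i j, i ≠ j → List.Disjoint (P i) (P j)) ∧
      (∀ i, N.IsPath N.S N.T1 (Q1 i)) ∧ (∀ i j, i ≠ j → List.Disjoint (Q1 i) (Q1 j)) ∧
      (∀ i j, List.Disjoint (Q1 i) (P j)) ∧
      (∀ i, N.IsPath N.S N.T2 (Q2 i)) ∧ (∀ i j, i ≠ j → List.Disjoint (Q2 i) (Q2 j)) ∧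
      (∀ i j, List.Disjoint (Q2 i) (P j)) := by
  classical
  obtain ⟨R, hR, -, hRd⟩ := N.exists_disjoint_walks (ι := Fin (h0 + h1) ⊕ Fin h2) Finset.univ
    (Sum.elim (fun _ => N.T1) fun _ => N.T2) (fun X hX => by
      have e1 := hc1 X hX
      have e2 := hc2 X hX
      have e12 := hc12 X hX
      have : demand (Sum.elim (fun _ : Fin (h0 + h1) => N.T1) fun _ : Fin h2 => N.T2) X =
          (if N.T1 ∈ X then h0 + h1 else 0) + (if N.T2 ∈ X then h2 else 0) := by
        by_cases t1 : N.T1 ∈ X <;> by_cases t2 : N.T2 ∈ X <;>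
          simp only [demand, Finset.card_filter, Fintype.sum_sum_type] <;> simp [t1, t2]
      rw [this]
      by_cases t1 : N.T1 ∈ X <;> by_cases t2 : N.T2 ∈ X <;> simp only [t1, t2, if_true, if_false]
      · exact e12 t1 t2
      · exact e1 t1
      · have := e2 t2; omega
      · exact Nat.zero_le _)
  obtain ⟨A, hA1, -, hA3, hA4, hA5⟩ := N.exists_reserved_walks Finset.univ N.T1 N.T2 h0 h2 h1
    (fun i => R (Sum.inl i)) (fun i => hR (Sum.inl i)) (by simp)
    (fun i j hij => hRd _ _ (by simpa using hij)) hc2 (by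
      refine cutAtLeast_of_walks (Fintype.card_fin h2) (P := fun i => R (Sum.inr i)) (fun i => hR (Sum.inr i))
        (fun i e he => ?_) (fun i j hij => hRd _ _ (by simpa using hij))
      simp only [Finset.mem_sdiff, Finset.mem_univ, true_and, Finset.mem_biUnion,
        List.mem_toFinset, not_exists]
      exact fun j hj => hRd (Sum.inl j) (Sum.inr i) (by simp) hj he)
  set F1 := Finset.univ \ Finset.univ.biUnion fun i => (A i).toFinset with hF1
  obtain ⟨R', hR'1, hR'2, hR'3⟩ := hA5.exists_walks
  obtain ⟨B, hB1, hB2, hB3, hB4, hB5⟩ := N.exists_reserved_walks F1 N.T2 N.T1 h0 0 h2 R' hR'1 hR'2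
    hR'3 hA4 (fun X _ _ => Nat.zero_le _)
  set F2 := F1 \ Finset.univ.biUnion fun i => (B i).toFinset with hF2
  obtain ⟨C1, hC11, hC12, hC13⟩ := hB5.exists_walks
  obtain ⟨C2, hC21, hC22, hC23⟩ := hB4.exists_walks
  choose A' hA' using fun i => (hA1 i).exists_isPath
  choose B' hB' using fun i => (hB1 i).exists_isPath
  choose C1' hC1' using fun i => (hC11 i).exists_isPath
  choose C2' hC2' using fun i => (hC21 i).exists_isPath
  have hAF1 : ∀ {e}, e ∈ F1 → ∀ i, e ∉ A' i := by
    intro e he i hi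
    simp only [hF1, Finset.mem_sdiff, Finset.mem_univ, true_and, Finset.mem_biUnion,
        List.mem_toFinset, not_exists] at he
    exact he i ((hA' i).1 hi)
  have hAF2 : ∀ {e}, e ∈ F2 → ∀ i, e ∉ Sum.elim A' B' i := by
    intro e he i hi
    have h := Finset.mem_sdiff.1 he
    rcases i with i | i
    · exact hAF1 h.1 i hi
    · simp only [Finset.mem_biUnion, Finset.mem_univ, true_and, List.mem_toFinset,
        not_exists] at h
      exact h.2 i ((hB' i).1 hi)
  refine ⟨Sum.elim A' B', C1', C2', fun i => (hA' i).2, fun i => (hB' i).2, ?_,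
    fun i => (hC1' i).2, fun i j hij e h1 h2 => hC13 i j hij ((hC1' i).1 h1) ((hC1' j).1 h2),
    fun i j e h1 h2 => hAF2 (hC12 i e ((hC1' i).1 h1)) j h2,
    fun i => (hC2' i).2, fun i j hij e h1 h2 => hC23 i j hij ((hC2' i).1 h1) ((hC2' j).1 h2),
    fun i j e h1 h2 => hAF2 (hC22 i e ((hC2' i).1 h1)) j h2⟩
  rintro (i | i) (j | j) hij e h1 h2
  · exact hA3 i j (by simpa using hij) ((hA' i).1 h1) ((hA' j).1 h2)
  · exact hAF1 (hB2 j e ((hB' j).1 h2)) i h1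
  · exact hAF1 (hB2 i e ((hB' i).1 h1)) j h2
  · exact hB3 i j (by simpa using hij) ((hB' i).1 h1) ((hB' j).1 h2)

end Network

/-! ### Transfer series of a linear code -/

namespace Network

variable {V E : Type*}

open PowerSeries

section Transfer

variable {R : Type*} [CommRing R] {M : Type*} [Fintype E]

/-- The symbol on an edge in slot `t` when the only nonzero source symbol is a `1` of the stream `m`
in slot `0`, for local coefficients `inj`, `ker` in a commutative ring. -/
def impulse (inj : E → M → R) (ker : E → E → R) (m : M) : ℕ → E → R
  | 0, _ => 0
  | t + 1, e => (if t = 0 then inj e m else 0) + ∑ e', ker e e' * impulse inj ker m t e'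

/-- The transfer function from the stream `m` to the edge `e`, a power series in the unit delay. -/
noncomputable def transfer (inj : E → M → R) (ker : E → E → R) (e : E) (m : M) : R⟦X⟧ :=
  PowerSeries.mk fun t => impulse inj ker m t e

theorem transfer_eq (inj : E → M → R) (ker : E → E → R) (e : E) (m : M) :
    transfer inj ker e m =
      X * (C (inj e m) + ∑ e', C (ker e e') * transfer inj ker e' m) := by
  ext t
  cases t with
  | zero => simp [transfer, impulse]
  | succ t => simp [transfer, impulse, PowerSeries.coeff_succ_X_mul, PowerSeries.coeff_C]

theorem map_transfer {R' : Type*} [CommRing R'] (φ : R →+* R') (inj : E → M → R)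
    (ker : E → E → R) (e : E) (m : M) :
    PowerSeries.map φ (transfer inj ker e m) =
      transfer (fun e m => φ (inj e m)) (fun e e' => φ (ker e e')) e m := by
  ext t
  simp only [transfer, PowerSeries.coeff_map, PowerSeries.coeff_mk]
  induction t generalizing e with
  | zero => simp [impulse]
  | succ t ih => simp [impulse, ih, apply_ite φ]

/-- The linear system that defines the signals of a code has at most one solution in power
series, because every edge has a delay. -/
theorem eq_of_delay_system {y z : E → R⟦X⟧} {b : E → R⟦X⟧} {ker : E → E → R}
    (hy : ∀ e, y e = X * (b e + ∑ e', C (ker e e') * y e'))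
    (hz : ∀ e, z e = X * (b e + ∑ e', C (ker e e') * z e')) : y = z := by
  have : ∀ t e, PowerSeries.coeff t (y e) = PowerSeries.coeff t (z e) := by
    intro t
    induction t with
    | zero => intro e; rw [hy, hz]; simp
    | succ t ih => intro e; rw [hy, hz]; simp [PowerSeries.coeff_succ_X_mul, ih]
  funext e
  ext t
  exact this t e

end Transfer

section Decoding

variable [Fintype E] {N : Network V E} {F : Type*} [Field F] {M : Type*} [Fintype M]

theorem LinearCode.mk_signal (c : N.LinearCode F M) (x : M → ℕ → F) (e : E) :
    PowerSeries.mk (fun t => c.signal x t e) =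
      ∑ m, transfer c.inj c.ker e m * PowerSeries.mk (x m) := by
  refine congrFun (eq_of_delay_system (ker := c.ker)
    (y := fun e => PowerSeries.mk fun t => c.signal x t e)
    (z := fun e => ∑ m, transfer c.inj c.ker e m * PowerSeries.mk (x m))
    (b := fun e => ∑ m, C (c.inj e m) * PowerSeries.mk (x m)) (fun e => ?_) fun e => ?_) e
  · ext t
    cases t with
    | zero => simp [LinearCode.signal]
    | succ t => simp [LinearCode.signal, PowerSeries.coeff_succ_X_mul]
  · simp only [Finset.mul_sum]
    rw [Finset.sum_comm, ← Finset.sum_add_distrib, Finset.mul_sum]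
    refine Finset.sum_congr rfl fun m _ => ?_
    conv_lhs => rw [transfer_eq]
    rw [mul_assoc, add_mul, Finset.sum_mul]
    simp only [mul_assoc]

theorem LinearCode.Decodes.mono {c : N.LinearCode F M} {T : V} {D D' : ℕ} {m : M}
    (h : c.Decodes T D m) (hD : D ≤ D') : c.Decodes T D' m :=
  fun x x' t hx => h x x' t fun e he s hs => hx e he s (by omega)

/-- A terminal recovers the streams `s j`, with bounded delay, as soon as it sees edges `l i` that
carry only these streams and have a nonsingular transfer matrix over the power series. The delay
is the order of the determinant: multiplying with the adjugate recovers the streams times the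
determinant. -/
theorem LinearCode.exists_decodes_of_det_ne_zero (c : N.LinearCode F M) {T : V} {κ : Type*}
    [Fintype κ] [DecidableEq κ] (l : κ → E) (hl : ∀ i, N.tgt (l i) = T) (s : κ → M)
    (hs : Function.Injective s)
    (h0 : ∀ i, ∀ m ∉ Set.range s, transfer c.inj c.ker (l i) m = 0)
    (hdet : (Matrix.of fun i j => transfer c.inj c.ker (l i) (s j)).det ≠ 0) :
    ∃ D, ∀ j, c.Decodes T D (s j) := by
  classical
  set A : Matrix κ κ F⟦X⟧ := Matrix.of fun i j => transfer c.inj c.ker (l i) (s j) with hA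
  refine ⟨A.det.order.toNat, fun j x x' t hx => ?_⟩
  set d : κ → F⟦X⟧ := fun j => PowerSeries.mk (x (s j)) - PowerSeries.mk (x' (s j)) with hd
  have hy : ∀ i, A.mulVec d i = PowerSeries.mk (fun t => c.signal x t (l i)) -
      PowerSeries.mk (fun t => c.signal x' t (l i)) := by
    intro i
    rw [c.mk_signal, c.mk_signal, ← Finset.sum_sub_distrib]
    simp only [← mul_sub]
    rw [← Finset.sum_subset (Finset.subset_univ (Finset.univ.image s)),
      Finset.sum_image hs.injOn]
    · rfl
    · intro m _ hm
      rw [h0 i m (by simpa using hm), zero_mul]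
  have hdvd : (X : F⟦X⟧) ^ (t + A.det.order.toNat + 1) ∣ A.det * d j := by
    have h1 : A.det * d j = A.adjugate.mulVec (A.mulVec d) j := by
      rw [Matrix.mulVec_mulVec, Matrix.adjugate_mul, Matrix.smul_mulVec, Matrix.one_mulVec]
      rfl
    rw [h1]
    refine Finset.dvd_sum fun i _ => Dvd.dvd.mul_left ?_ _
    rw [hy, PowerSeries.X_pow_dvd_iff]
    intro s hs
    rw [map_sub, PowerSeries.coeff_mk, PowerSeries.coeff_mk, hx (l i) (hl i) s (by omega), sub_self]
  have hord : ((t + 1 : ℕ) : ℕ∞) ≤ (d j).order := by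
    have h1 : ((t + A.det.order.toNat + 1 : ℕ) : ℕ∞) ≤ (A.det * d j).order := by
      refine PowerSeries.nat_le_order _ _ fun i hi => ?_
      exact PowerSeries.X_pow_dvd_iff.1 hdvd i hi
    rw [PowerSeries.order_mul] at h1
    obtain ⟨n, hn⟩ := ENat.ne_top_iff_exists.1 (mt PowerSeries.order_eq_top.1 hdet)
    rw [← hn, ENat.toNat_natCast] at h1
    cases hdj : (d j).order with
    | top => exact le_top
    | coe k =>
      rw [hdj] at h1
      norm_cast at h1 ⊢
      omega
  have := PowerSeries.coeff_of_lt_order t (lt_of_lt_of_le (by norm_cast; omega) hord)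
  simpa [hd, sub_eq_zero] using this

theorem LinearCode.exists_common_delay (c : N.LinearCode F M) {T : V} {κ : Type*} [Finite κ]
    (s : κ → M) (h : ∀ k, ∃ D, c.Decodes T D (s k)) : ∃ D, ∀ k, c.Decodes T D (s k) := by
  choose D hD using h
  cases nonempty_fintype κ
  exact ⟨∑ k, D k, fun k => (hD k).mono (Finset.single_le_sum (fun _ _ => Nat.zero_le _)
    (Finset.mem_univ k))⟩

end Decoding

/-! ### Routing -/

theorem pair_infix_iff {p : List E} {a b : E} :
    [a, b] <:+: p ↔ ∃ k : ℕ, p[k]? = some a ∧ p[k + 1]? = some b := by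
  constructor
  · rintro ⟨s, t, rfl⟩
    exact ⟨s.length, by simp, by simp⟩
  · rintro ⟨k, ha, hb⟩
    obtain ⟨hk, rfl⟩ := List.getElem?_eq_some_iff.1 ha
    obtain ⟨hk', rfl⟩ := List.getElem?_eq_some_iff.1 hb
    refine ⟨p.take k, p.drop (k + 2), ?_⟩
    rw [List.append_assoc]
    conv_rhs => rw [← List.take_append_drop k p, List.drop_eq_getElem_cons hk,
      List.drop_eq_getElem_cons hk']
    rfl

open Classical in
/-- The local coefficients route the stream `m` along `p`: `LinearCode.Routes` for coefficients in a
commutative ring. -/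
def IsRouted {R : Type*} [CommRing R] {M : Type*} (inj : E → M → R) (ker : E → E → R) (m : M)
    (p : List E) : Prop :=
  (∀ e, p.head? = some e → (∀ m', inj e m' = if m' = m then 1 else 0) ∧ ∀ e', ker e e' = 0) ∧
  (∀ e' e, [e', e] <:+: p →
    (∀ m', inj e m' = 0) ∧ ∀ e'', ker e e'' = if e'' = e' then 1 else 0)

open Classical in
theorem IsRouted.transfer_eq {R : Type*} [CommRing R] {M : Type*} [Fintype E] {inj : E → M → R}
    {ker : E → E → R} {m : M} {p : List E} (h : IsRouted inj ker m p) {k : ℕ} {e : E}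
    (he : p[k]? = some e) (m' : M) :
    transfer inj ker e m' = if m' = m then X ^ (k + 1) else 0 := by
  induction k generalizing e with
  | zero =>
    rw [← List.head?_eq_getElem?] at he
    rw [Network.transfer_eq, (h.1 e he).1]
    by_cases hm : m' = m <;> simp [hm, (h.1 e he).2]
  | succ k ih =>
    have hk : k < p.length := by
      have := (List.getElem?_eq_some_iff.1 he).1
      omega
    have he' : p[k]? = some p[k] := List.getElem?_eq_getElem hk
    obtain ⟨h1, h2⟩ := h.2 p[k] e (pair_infix_iff.2 ⟨k, he', he⟩)
    rw [Network.transfer_eq, h1, Finset.sum_eq_single p[k], h2, ih he']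
    · by_cases hm : m' = m <;> simp [hm, pow_succ']
    · intro e'' _ hne
      simp [h2, hne]
    · simp

theorem IsWalk.src_of_head? {N : Network V E} {u v : V} {p : List E} (h : N.IsWalk u v p) {e : E}
    (he : p.head? = some e) : N.src e = u := by
  cases p with
  | nil => simp at he
  | cons a p => obtain rfl : a = e := by simpa using he
                exact h.1

theorem IsWalk.tgt_eq_src {N : Network V E} {u v : V} {p : List E} (h : N.IsWalk u v p) {k : ℕ}
    {a b : E} (ha : p[k]? = some a) (hb : p[k + 1]? = some b) : N.tgt a = N.src b := by
  induction p generalizing u k with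
  | nil => simp at ha
  | cons c p ih =>
    cases k with
    | zero =>
      obtain rfl : c = a := by simpa using ha
      exact (h.2.src_of_head? (by simpa [List.head?_eq_getElem?] using hb)).symm
    | succ k => exact ih h.2 (by simpa using ha) (by simpa using hb)

theorem IsWalk.exists_last {N : Network V E} {u v : V} {p : List E} (h : N.IsWalk u v p)
    (huv : u ≠ v) : ∃ (k : ℕ) (e : E), p[k]? = some e ∧ N.tgt e = v := by
  induction p generalizing u with
  | nil => exact absurd h huv
  | cons a p ih =>
    by_cases ha : N.tgt a = v
    · exact ⟨0, a, by simp, ha⟩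
    · obtain ⟨k, e, h1, h2⟩ := ih h.2 ha
      exact ⟨k + 1, e, by simpa using h1, h2⟩

/-- `P` is a family of pairwise edge-disjoint paths that start at the source. -/
def IsPathFamily (N : Network V E) {ι : Type*} (P : ι → List E) : Prop :=
  (∀ i, ∃ v, N.IsPath N.S v (P i)) ∧ ∀ i j, i ≠ j → List.Disjoint (P i) (P j)

namespace IsPathFamily

variable {N : Network V E} {ι : Type*} {P : ι → List E} (h : N.IsPathFamily P)
include h

theorem index_unique {e : E} {i j : ι} (hi : e ∈ P i) (hj : e ∈ P j) : i = j := by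
  by_contra hne
  exact h.2 i j hne hi hj

theorem nodup (i : ι) : (P i).Nodup := by
  obtain ⟨v, -, hv⟩ := h.1 i
  exact (List.nodup_cons.1 hv).2.of_map

theorem src_of_head? {i : ι} {e : E} (he : (P i).head? = some e) : N.src e = N.S := by
  obtain ⟨v, hv, -⟩ := h.1 i
  exact hv.src_of_head? he

theorem tgt_eq_src {i : ι} {e e' : E} (he : [e', e] <:+: P i) : N.tgt e' = N.src e := by
  obtain ⟨v, hv, -⟩ := h.1 i
  obtain ⟨k, h1, h2⟩ := pair_infix_iff.1 he
  exact hv.tgt_eq_src h1 h2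

theorem not_infix_of_head? {i j : ι} {e e' : E} (he : (P i).head? = some e) :
    ¬ [e', e] <:+: P j := by
  intro hinf
  obtain rfl := h.index_unique (List.mem_of_mem_head? he) (hinf.subset (by simp : e ∈ [e', e]))
  obtain ⟨k, -, h2⟩ := pair_infix_iff.1 hinf
  rw [List.head?_eq_getElem?] at he
  obtain ⟨h3, h4⟩ := List.getElem?_eq_some_iff.1 he
  obtain ⟨h5, h6⟩ := List.getElem?_eq_some_iff.1 h2
  have := ((h.nodup i).getElem_inj_iff (hi := h3) (hj := h5)).1 (h4.trans h6.symm)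
  omega

theorem pred_unique {i j : ι} {e e' e'' : E} (h1 : [e', e] <:+: P i) (h2 : [e'', e] <:+: P j) :
    e'' = e' := by
  obtain rfl := h.index_unique (h1.subset (by simp : e ∈ [e', e]))
    (h2.subset (by simp : e ∈ [e'', e]))
  obtain ⟨k, hk, hk1⟩ := pair_infix_iff.1 h1
  obtain ⟨k', hk', hk1'⟩ := pair_infix_iff.1 h2
  obtain ⟨h3, h4⟩ := List.getElem?_eq_some_iff.1 hk1
  obtain ⟨h5, h6⟩ := List.getElem?_eq_some_iff.1 hk1'
  have := ((h.nodup i).getElem_inj_iff (hi := h3) (hj := h5)).1 (h4.trans h6.symm)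
  obtain rfl : k = k' := by omega
  exact Option.some.inj (hk'.symm.trans hk)

end IsPathFamily

/-! ### Generic coding of the common message next to routed streams -/

section RoutedCoefficients

variable (N : Network V E) {ι κ : Type*} (P : ι → List E) {R R' : Type*} [CommRing R] [CommRing R']

open Classical in
/-- Source coefficients of the code that routes the streams `Sum.inr i` along `P i` and mixes the
streams `Sum.inl m` on all other edges, with coefficients `ξ`. -/
noncomputable def routedInj (ξ : (E × κ) ⊕ (E × E) → R) (e : E) : κ ⊕ ι → R
  | Sum.inl m => if N.src e = N.S ∧ ∀ i, e ∉ P i then ξ (Sum.inl (e, m)) else 0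
  | Sum.inr i => if (P i).head? = some e then 1 else 0

open Classical in
/-- Edge coefficients of the code that routes the streams `Sum.inr i` along `P i` and mixes the
streams `Sum.inl m` on all other edges, with coefficients `ξ`. -/
noncomputable def routedKer (ξ : (E × κ) ⊕ (E × E) → R) (e e' : E) : R :=
  if ∃ i, [e', e] <:+: P i then 1
  else if (∀ i, e ∉ P i) ∧ (∀ i, e' ∉ P i) ∧ N.tgt e' = N.src e then ξ (Sum.inr (e, e')) else 0

variable {N P}

theorem isRouted_of_isPathFamily (hP : N.IsPathFamily P) (ξ : (E × κ) ⊕ (E × E) → R) (i : ι) :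
    IsRouted (routedInj N P ξ) (routedKer N P ξ) (Sum.inr i) (P i) := by
  refine ⟨fun e he => ⟨?_, fun e' => ?_⟩, fun e' e he => ⟨?_, fun e'' => ?_⟩⟩
  · have hei := List.mem_of_mem_head? he
    rintro (m | j)
    · rw [if_neg (by simp)]
      exact if_neg fun h => h.2 i hei
    · by_cases hj : j = i
      · subst hj; simp [routedInj, he]
      · rw [if_neg (by simpa using hj)]
        exact if_neg fun h => hj (hP.index_unique (List.mem_of_mem_head? h) hei)
  · have hei := List.mem_of_mem_head? he
    rw [routedKer, if_neg fun ⟨j, hj⟩ => hP.not_infix_of_head? he hj, if_neg fun h => h.1 i hei]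
  · have hei : e ∈ P i := he.subset (by simp)
    rintro (m | j)
    · exact if_neg fun h => h.2 i hei
    · exact if_neg fun h => hP.not_infix_of_head? h he
  · have hei : e ∈ P i := he.subset (by simp)
    by_cases h : e'' = e'
    · subst h
      rw [if_pos rfl, routedKer, if_pos ⟨i, he⟩]
    · rw [if_neg h, routedKer, if_neg fun ⟨j, hj⟩ => h (hP.pred_unique he hj),
        if_neg fun h => h.1 i hei]

open Classical in
/-- The coefficients that route the streams `Sum.inl m` along `Q m`. -/
noncomputable def routingPoint (Q : κ → List E) : (E × κ) ⊕ (E × E) → R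
  | Sum.inl (e, m) => if (Q m).head? = some e then 1 else 0
  | Sum.inr (e, e') => if ∃ m, [e', e] <:+: Q m then 1 else 0

theorem isRouted_routingPoint {Q : κ → List E} (hQ : N.IsPathFamily Q)
    (hQP : ∀ m i, List.Disjoint (Q m) (P i)) (m : κ) :
    IsRouted (routedInj N P (routingPoint Q : _ → R)) (routedKer N P (routingPoint Q))
      (Sum.inl m) (Q m) := by
  have hker : ∀ e ∈ Q m, ∀ e', routedKer N P (routingPoint Q : _ → R) e e' =
      open Classical in if ∃ m, [e', e] <:+: Q m then 1 else 0 := by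
    intro e he e'
    classical
    have heP : ∀ i, e ∉ P i := fun i hi => hQP m i he hi
    rw [routedKer, if_neg fun ⟨i, hi⟩ => heP i (hi.subset (by simp : e ∈ [e', e]))]
    by_cases h : ∃ m, [e', e] <:+: Q m
    · obtain ⟨j, hj⟩ := h
      rw [if_pos ⟨heP, fun i hi => hQP j i (hj.subset (by simp : e' ∈ [e', e])) hi,
        hQ.tgt_eq_src hj⟩]
      rfl
    · rw [if_neg h]
      exact ite_eq_right_iff.2 fun _ => if_neg h
  classical
  refine ⟨fun e he => ⟨?_, fun e' => ?_⟩, fun e' e he => ⟨?_, fun e'' => ?_⟩⟩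
  · have hem := List.mem_of_mem_head? he
    have heP : ∀ i, e ∉ P i := fun i hi => hQP m i hem hi
    rintro (j | i)
    · simp only [routedInj, if_pos (And.intro (hQ.src_of_head? he) heP)]
      by_cases hj : j = m
      · subst hj; simp [routingPoint, he]
      · rw [if_neg (by simpa using hj)]
        exact if_neg fun h => hj (hQ.index_unique (List.mem_of_mem_head? h) hem)
    · rw [if_neg (by simp)]
      exact if_neg fun h => heP i (List.mem_of_mem_head? h)
  · rw [hker e (List.mem_of_mem_head? he), if_neg fun ⟨j, hj⟩ => hQ.not_infix_of_head? he hj]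
  · have hem : e ∈ Q m := he.subset (by simp)
    rintro (j | i)
    · exact ite_eq_right_iff.2 fun _ => if_neg fun h => hQ.not_infix_of_head? h he
    · exact if_neg fun h => hQP m i hem (List.mem_of_mem_head? h)
  · rw [hker e (he.subset (by simp))]
    by_cases h : e'' = e'
    · subst h
      rw [if_pos rfl, if_pos ⟨m, he⟩]
    · rw [if_neg h, if_neg fun ⟨j, hj⟩ => h (hQ.pred_unique he hj)]

variable [Fintype E]

/-- Edges outside of the routing paths carry nothing of the routed streams. -/
theorem transfer_routed_eq_zero (ξ : (E × κ) ⊕ (E × E) → R) {e : E} (he : ∀ i, e ∉ P i) (i : ι) :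
    transfer (routedInj N P ξ) (routedKer N P ξ) e (Sum.inr i) = 0 := by
  ext t
  simp only [transfer, PowerSeries.coeff_mk, map_zero]
  induction t generalizing e with
  | zero => rfl
  | succ t ih =>
    have h1 : routedInj N P ξ e (Sum.inr i) = 0 :=
      if_neg fun h => he i (List.mem_of_mem_head? h)
    rw [impulse, h1, ite_self, zero_add]
    refine Finset.sum_eq_zero fun e' _ => ?_
    by_cases he' : ∀ i, e' ∉ P i
    · rw [ih he', mul_zero]
    · rw [routedKer, if_neg fun ⟨i, hi⟩ => he i (hi.subset (by simp)), if_neg fun h => he' h.2.1,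
        zero_mul]

variable [Fintype κ] [DecidableEq κ]

variable (N P) in
/-- The determinant of the transfer matrix from the streams `Sum.inl m` to the edges `l i`. -/
noncomputable def transferDet (ξ : (E × κ) ⊕ (E × E) → R) (l : κ → E) : R⟦X⟧ :=
  (Matrix.of fun i j => transfer (routedInj N P ξ) (routedKer N P ξ) (l i) (Sum.inl j)).det

theorem map_transferDet (φ : R →+* R') (ξ : (E × κ) ⊕ (E × E) → R) (l : κ → E) :
    PowerSeries.map φ (transferDet N P ξ l) = transferDet N P (fun s => φ (ξ s)) l := by
  have h1 : (fun e m => φ (routedInj N P ξ e m)) = routedInj N P fun s => φ (ξ s) := by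
    funext e m
    rcases m with m | i <;> simp only [routedInj, apply_ite φ, map_zero, map_one]
  have h2 : (fun e e' => φ (routedKer N P ξ e e')) = routedKer N P fun s => φ (ξ s) := by
    funext e e'
    simp only [routedKer, apply_ite φ, map_zero, map_one]
  rw [transferDet, RingHom.map_det, transferDet]
  congr 1
  ext1 i j
  simp only [RingHom.mapMatrix_apply, Matrix.map_apply, Matrix.of_apply, map_transfer, h1, h2]

theorem transferDet_routingPoint_ne_zero [IsDomain R] {Q : κ → List E} (hQ : N.IsPathFamily Q)
    (hQP : ∀ m i, List.Disjoint (Q m) (P i)) {l : κ → E} {k : κ → ℕ}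
    (hl : ∀ m, (Q m)[k m]? = some (l m)) :
    transferDet N P (routingPoint Q : _ → R) l ≠ 0 := by
  have : (Matrix.of fun i j => transfer (routedInj N P (routingPoint Q : _ → R))
      (routedKer N P (routingPoint Q)) (l i) (Sum.inl j)) =
      Matrix.diagonal fun m => (X : R⟦X⟧) ^ (k m + 1) := by
    ext1 i j
    rw [Matrix.of_apply, (isRouted_routingPoint hQ hQP i).transfer_eq (hl i), Matrix.diagonal_apply]
    by_cases h : i = j
    · simp [h]
    · simp [h, Ne.symm h]
  rw [transferDet, this, Matrix.det_diagonal, Finset.prod_pow_eq_pow_sum]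
  exact pow_ne_zero _ PowerSeries.X_ne_zero

/-- Some coefficients in a finite field of characteristic `2` make both transfer matrices
nonsingular. With indeterminates as coefficients both determinants are nonzero, since routing along
the paths `Q1` or `Q2` is a specialisation; so some coefficient of their product is a nonzero
polynomial, which does not vanish at some point over the algebraic closure of `ZMod 2`, and the
coordinates of this point generate a finite field. -/
theorem exists_finite_field_transferDet_ne_zero {Q1 Q2 : κ → List E}
    (hQ1 : N.IsPathFamily Q1) (hQP1 : ∀ m i, List.Disjoint (Q1 m) (P i))
    (hQ2 : N.IsPathFamily Q2) (hQP2 : ∀ m i, List.Disjoint (Q2 m) (P i))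
    {l1 l2 : κ → E} {k1 k2 : κ → ℕ} (hl1 : ∀ m, (Q1 m)[k1 m]? = some (l1 m))
    (hl2 : ∀ m, (Q2 m)[k2 m]? = some (l2 m)) :
    ∃ (F : Type) (_ : Field F), Finite F ∧ CharP F 2 ∧ ∃ ξ : (E × κ) ⊕ (E × E) → F,
      transferDet N P ξ l1 ≠ 0 ∧ transferDet N P ξ l2 ≠ 0 := by
  let K := AlgebraicClosure (ZMod 2)
  let G := MvPolynomial ((E × κ) ⊕ (E × E)) K
  have hgen : ∀ (Q : κ → List E) (l : κ → E), transferDet N P (routingPoint Q : _ → K) l ≠ 0 →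
      transferDet N P (fun s => (MvPolynomial.X s : G)) l ≠ 0 := by
    intro Q l h h'
    apply h
    have := map_transferDet (N := N) (P := P) (MvPolynomial.eval (routingPoint Q : _ → K))
      (fun s => (MvPolynomial.X s : G)) l
    simp only [MvPolynomial.eval_X] at this
    rw [← this, h', map_zero]
  have hprod := mul_ne_zero (hgen Q1 l1 (transferDet_routingPoint_ne_zero hQ1 hQP1 hl1))
    (hgen Q2 l2 (transferDet_routingPoint_ne_zero hQ2 hQP2 hl2))
  obtain ⟨n, hn⟩ : ∃ n, PowerSeries.coeff n (transferDet N P (fun s => (MvPolynomial.X s : G)) l1 *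
      transferDet N P (fun s => (MvPolynomial.X s : G)) l2) ≠ 0 := by
    by_contra hcon
    push Not at hcon
    exact hprod (PowerSeries.ext (by simpa using hcon))
  obtain ⟨x, hx⟩ : ∃ x : (E × κ) ⊕ (E × E) → K, MvPolynomial.eval x (PowerSeries.coeff n
      (transferDet N P (fun s => (MvPolynomial.X s : G)) l1 *
        transferDet N P (fun s => (MvPolynomial.X s : G)) l2)) ≠ 0 := by
    by_contra hcon
    push Not at hcon
    exact hn (MvPolynomial.funext (by simpa using hcon))
  have hxK : transferDet N P x l1 * transferDet N P x l2 ≠ 0 := by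
    intro h0
    apply hx
    rw [← PowerSeries.coeff_map, map_mul, map_transferDet, map_transferDet]
    simp only [MvPolynomial.eval_X]
    rw [h0, map_zero]
  let L := IntermediateField.adjoin (ZMod 2) (Set.range x)
  have hfd : FiniteDimensional (ZMod 2) L :=
    IntermediateField.finiteDimensional_adjoin fun y _ => Algebra.IsIntegral.isIntegral y
  have hmem : ∀ s, x s ∈ L := fun s => IntermediateField.subset_adjoin _ _ ⟨s, rfl⟩
  have hdet : ∀ l, PowerSeries.map (algebraMap L K)
      (transferDet N P (fun s => (⟨x s, hmem s⟩ : L)) l) = transferDet N P x l :=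
    fun l => map_transferDet (algebraMap L K) _ l
  refine ⟨L, inferInstance, Module.finite_of_finite (ZMod 2), charP_of_injective_algebraMap
    (algebraMap (ZMod 2) L).injective 2, fun s => ⟨x s, hmem s⟩, fun h => hxK ?_, fun h => hxK ?_⟩
  · rw [← hdet l1, h, map_zero, zero_mul]
  · rw [← hdet l2, h, map_zero, mul_zero]

end RoutedCoefficients

/-- The code that routes the streams `Sum.inr i` along `P i` and mixes the streams `Sum.inl m` on all
other edges with coefficients `ξ`. -/
noncomputable def routedCode (N : Network V E) {ι κ F : Type*} [Field F] (P : ι → List E)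
    (hP : N.IsPathFamily P) (ξ : (E × κ) ⊕ (E × E) → F) : N.LinearCode F (κ ⊕ ι) where
  inj := routedInj N P ξ
  ker := routedKer N P ξ
  inj_eq_zero := by
    rintro e (m | i) he
    · exact if_neg fun h => he h.1
    · exact if_neg fun h => he (hP.src_of_head? h)
  ker_eq_zero := by
    intro e e' he
    rw [routedKer, if_neg fun ⟨i, hi⟩ => he (hP.tgt_eq_src hi), if_neg fun h => he h.2.2]

/-- Cut inequalities with integer rates, for the terminals' side of each cut, give a solution with
routed private messages. -/
theorem routedSolvable_of_cutAtLeast [Finite V] [Fintype E] (N : Network V E) (hT1 : N.S ≠ N.T1)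
    (hT2 : N.S ≠ N.T2) {h0 h1 h2 : ℕ} (hc1 : N.CutAtLeast Finset.univ N.T1 (h0 + h1))
    (hc2 : N.CutAtLeast Finset.univ N.T2 (h0 + h2))
    (hc12 : ∀ X, N.S ∉ X → N.T1 ∈ X → N.T2 ∈ X → h0 + h1 + h2 ≤ N.inDeg Finset.univ X) :
    ∃ (F : Type) (_ : Field F), Finite F ∧ CharP F 2 ∧ N.RoutedSolvable F h0 h1 h2 := by
  obtain ⟨P, Q1, Q2, hP1, hP2, hPd, hQ1, hQ1d, hQ1P, hQ2, hQ2d, hQ2P⟩ :=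
    N.exists_paths hc1 hc2 hc12
  have hPf : N.IsPathFamily P := ⟨by
    rintro (i | i)
    · exact ⟨_, hP1 i⟩
    · exact ⟨_, hP2 i⟩, hPd⟩
  have hQ1f : N.IsPathFamily Q1 := ⟨fun i => ⟨_, hQ1 i⟩, hQ1d⟩
  have hQ2f : N.IsPathFamily Q2 := ⟨fun i => ⟨_, hQ2 i⟩, hQ2d⟩
  choose k1 l1 hl1 ht1 using fun i => (hQ1 i).1.exists_last hT1
  choose k2 l2 hl2 ht2 using fun i => (hQ2 i).1.exists_last hT2
  obtain ⟨F, hF, hfin, hchar, ξ, hd1, hd2⟩ :=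
    exists_finite_field_transferDet_ne_zero hQ1f hQ1P hQ2f hQ2P hl1 hl2
  refine ⟨F, hF, hfin, hchar, N.routedCode P hPf ξ, P, ?_, hP1, hP2, hPd,
    fun i => isRouted_of_isPathFamily hPf ξ i, ?_⟩
  · have hcommon : ∀ {T : V} {Q : Fin h0 → List E} {l : Fin h0 → E} {k : Fin h0 → ℕ},
        (∀ i j, List.Disjoint (Q i) (P j)) → (∀ i, (Q i)[k i]? = some (l i)) →
        (∀ i, N.tgt (l i) = T) → transferDet N P ξ l ≠ 0 →
        ∃ D, ∀ i, (N.routedCode P hPf ξ).Decodes T D (Sum.inl i) := by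
      intro T Q l k hQP hl ht hd
      refine (N.routedCode P hPf ξ).exists_decodes_of_det_ne_zero l ht Sum.inl Sum.inl_injective
        ?_ hd
      rintro i (m | j) hm
      · exact absurd ⟨m, rfl⟩ hm
      · exact transfer_routed_eq_zero ξ
          (fun j' hj' => hQP i j' (List.mem_of_getElem? (hl i)) hj') j
    have hprivate : ∀ {T : V} (i : Fin h1 ⊕ Fin h2), N.S ≠ T → N.IsPath N.S T (P i) →
        ∃ D, (N.routedCode P hPf ξ).Decodes T D (Sum.inr i) := by
      intro T i hT hi
      obtain ⟨k, e, hk, he⟩ := hi.1.exists_last hT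
      have htr := (isRouted_of_isPathFamily hPf ξ i).transfer_eq hk
      obtain ⟨D, hD⟩ := (N.routedCode P hPf ξ).exists_decodes_of_det_ne_zero (κ := Unit)
        (fun _ => e) (fun _ => he) (fun _ => Sum.inr i) (fun _ _ _ => rfl)
        (fun _ m hm => (htr m).trans (if_neg fun h => hm ⟨(), h.symm⟩)) (by
          rw [Matrix.det_unique, Matrix.of_apply]
          refine ne_of_eq_of_ne (htr _) ?_
          rw [if_pos rfl]
          exact pow_ne_zero _ PowerSeries.X_ne_zero)
      exact ⟨D, hD ()⟩
    obtain ⟨D1, hD1⟩ := hcommon hQ1P hl1 ht1 hd1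
    obtain ⟨D2, hD2⟩ := hcommon hQ2P hl2 ht2 hd2
    obtain ⟨D3, hD3⟩ := (N.routedCode P hPf ξ).exists_common_delay (fun i => Sum.inr (Sum.inl i))
      fun i => hprivate (Sum.inl i) hT1 (hP1 i)
    obtain ⟨D4, hD4⟩ := (N.routedCode P hPf ξ).exists_common_delay (fun i => Sum.inr (Sum.inr i))
      fun i => hprivate (Sum.inr i) hT2 (hP2 i)
    exact ⟨D1 + D2 + D3 + D4, fun i => (hD1 i).mono (by omega), fun i => (hD3 i).mono (by omega),
      fun i => (hD2 i).mono (by omega), fun i => (hD4 i).mono (by omega)⟩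
  · intro e he
    refine ⟨fun i => if_neg fun h => he i (List.mem_of_mem_head? h), fun i e' he' => ?_⟩
    show routedKer N P ξ e e' = 0
    rw [routedKer, if_neg fun ⟨j, hj⟩ => he j (hj.subset (by simp)), if_neg fun h => h.2.1 i he']

end Network

/-! ### Cut bounds -/

namespace Network

variable {V E : Type*}

theorem le_minCut_iff [Fintype E] (N : Network V E) {U : Set V} (hU : N.S ∉ U) (H : ℝ) :
    H ≤ (N.minCut U : ℝ) ↔ ∀ C : Set V, N.S ∈ C → Disjoint U C → H ≤ N.cutCapacity C := by
  constructor
  · intro h C hS hC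
    exact h.trans (Nat.cast_le.2 (Nat.sInf_le ⟨C, hS, hC, rfl⟩))
  · intro h
    obtain ⟨C, hS, hC, hk⟩ := Nat.sInf_mem
      (s := {k | ∃ C : Set V, N.S ∈ C ∧ Disjoint U C ∧ k = N.cutCapacity C})
      ⟨_, Uᶜ, hU, disjoint_compl_right, rfl⟩
    rw [minCut, hk]
    exact h C hS hC

theorem cutBounds_iff [Fintype E] (N : Network V E) (hT1 : N.S ≠ N.T1) (hT2 : N.S ≠ N.T2)
    (H0 H1 H2 : ℝ) :
    N.CutBounds H0 H1 H2 ↔ ∀ C : Set V, N.S ∈ C →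
      (N.T1 ∉ C → H0 + H1 ≤ N.cutCapacity C) ∧ (N.T2 ∉ C → H0 + H2 ≤ N.cutCapacity C) ∧
      (N.T1 ∉ C → N.T2 ∉ C → H0 + H1 + H2 ≤ N.cutCapacity C) := by
  rw [CutBounds, N.le_minCut_iff (by simpa using hT1), N.le_minCut_iff (by simpa using hT2),
    N.le_minCut_iff (by simpa using ⟨hT1, hT2⟩)]
  simp only [Set.disjoint_insert_left, Set.disjoint_singleton_left]
  exact ⟨fun h C hC => ⟨h.1 C hC, h.2.1 C hC, fun h1 h2 => h.2.2 C hC ⟨h1, h2⟩⟩,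
    fun h => ⟨fun C hC => (h C hC).1, fun C hC => (h C hC).2.1,
      fun C hC h12 => (h C hC).2.2 h12.1 h12.2⟩⟩

theorem cutCapacity_scale [Fintype E] (N : Network V E) (n : ℕ) (C : Set V) :
    (N.scale n).cutCapacity C = N.cutCapacity C * n := by
  classical
  rw [cutCapacity, cutCapacity]
  conv_rhs => rw [← Fintype.card_fin n, ← Finset.card_univ, ← Finset.card_product]
  congr 1
  ext ⟨e, j⟩
  rw [Finset.mem_product, Finset.mem_filter, Finset.mem_filter]
  simp [scale]

theorem exists_routedSolvable [Finite V] [Fintype E] (N : Network V E) (hT1 : N.S ≠ N.T1)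
    (hT2 : N.S ≠ N.T2) {h0 h1 h2 : ℕ} (h : N.CutBounds h0 h1 h2) :
    ∃ (F : Type) (_ : Field F), Finite F ∧ CharP F 2 ∧ N.RoutedSolvable F h0 h1 h2 := by
  rw [N.cutBounds_iff hT1 hT2] at h
  have hX : ∀ X : Set V, N.inDeg Finset.univ X = N.cutCapacity Xᶜ := fun X => by
    rw [cutCapacity_eq_inDeg, compl_compl]
  refine N.routedSolvable_of_cutAtLeast hT1 hT2 (fun X hS hT => ?_) (fun X hS hT => ?_)
    fun X hS h1 h2 => ?_
  · rw [hX]; exact_mod_cast (h Xᶜ hS).1 (by simpa using hT)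
  · rw [hX]; exact_mod_cast (h Xᶜ hS).2.1 (by simpa using hT)
  · rw [hX]; exact_mod_cast (h Xᶜ hS).2.2 (by simpa using h1) (by simpa using h2)

theorem CutBounds.scale_floor [Fintype E] {N : Network V E} (hT1 : N.S ≠ N.T1) (hT2 : N.S ≠ N.T2)
    {H0 H1 H2 : ℝ} (hH0 : 0 ≤ H0) (hH1 : 0 ≤ H1) (hH2 : 0 ≤ H2) (h : N.CutBounds H0 H1 H2)
    (n : ℕ) : (N.scale n).CutBounds ⌊n * H0⌋₊ ⌊n * H1⌋₊ ⌊n * H2⌋₊ := by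
  rw [cutBounds_iff (N.scale n) hT1 hT2]
  rw [N.cutBounds_iff hT1 hT2] at h
  have f0 := Nat.floor_le (mul_nonneg n.cast_nonneg hH0 : (0 : ℝ) ≤ n * H0)
  have f1 := Nat.floor_le (mul_nonneg n.cast_nonneg hH1 : (0 : ℝ) ≤ n * H1)
  have f2 := Nat.floor_le (mul_nonneg n.cast_nonneg hH2 : (0 : ℝ) ≤ n * H2)
  intro C hC
  obtain ⟨h1, h2, h12⟩ := h C hC
  rw [cutCapacity_scale, Nat.cast_mul]
  refine ⟨fun t1 => ?_, fun t2 => ?_, fun t1 t2 => ?_⟩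
  · have := mul_le_mul_of_nonneg_right (h1 t1) (n.cast_nonneg (α := ℝ))
    linarith
  · have := mul_le_mul_of_nonneg_right (h2 t2) (n.cast_nonneg (α := ℝ))
    linarith
  · have := mul_le_mul_of_nonneg_right (h12 t1 t2) (n.cast_nonneg (α := ℝ))
    linarith

/-! ### The converse for arbitrary codes -/

namespace BlockCode

variable {N : Network V E} {q L m0 m1 m2 : ℕ}

/-- The symbols on the edges of a cut determine everything that is received beyond the cut. -/
theorem sym_eq_of_cut (c : N.BlockCode q L m0 m1 m2) {C : Set V} (hS : N.S ∈ C)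
    {w w' : Fin m0 × Fin m1 × Fin m2}
    (h : ∀ e, N.src e ∈ C → N.tgt e ∉ C → c.sym w e = c.sym w' e) (e : E) (he : N.tgt e ∉ C) :
    c.sym w e = c.sym w' e := by
  funext t
  induction t using WellFoundedLT.induction generalizing e with
  | ind t ih =>
    by_cases hs : N.src e ∈ C
    · rw [h e hs he]
    · exact c.causal e (fun h => hs (h ▸ hS)) t w w' fun e' he' s hst =>
        ih s hst e' (he' ▸ hs)

open Classical in
/-- If the symbols on a cut together with side information `g` determine the correctly decoded
messages, then the cut bounds the number of these messages. -/
theorem card_correct_le [Fintype E] (c : N.BlockCode q L m0 m1 m2) (C : Set V)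
    {B : Type*} [Fintype B] (g : Fin m0 × Fin m1 × Fin m2 → B)
    (hg : ∀ w w', c.Correct w → c.Correct w' →
      (∀ e, N.src e ∈ C → N.tgt e ∉ C → c.sym w e = c.sym w' e) → g w = g w' → w = w') :
    (Finset.univ.filter fun w => c.Correct w).card ≤
      q ^ (L * N.cutCapacity C) * Fintype.card B := by
  let φ : {w // c.Correct w} → ({e // N.src e ∈ C ∧ N.tgt e ∉ C} → Fin L → Fin q) × B :=
    fun w => (fun e => c.sym w e, g w)
  have hφ : Function.Injective φ := fun w w' h => Subtype.ext <|
    hg w w' w.2 w'.2 (fun e h1 h2 => congrFun (congrArg Prod.fst h) ⟨e, h1, h2⟩)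
      (congrArg Prod.snd h)
  have := Fintype.card_le_of_injective φ hφ
  rw [Fintype.card_subtype, Fintype.card_prod, Fintype.card_fun, Fintype.card_fun,
    Fintype.card_fin, Fintype.card_fin, Fintype.card_subtype, ← pow_mul] at this
  exact this

open Classical in
theorem le_card_correct (c : N.BlockCode q L m0 m1 m2) {δ : ℝ} (hc : c.errorProb ≤ δ)
    (hm : 0 < (m0 : ℝ) * m1 * m2) :
    (1 - δ) * (m0 * m1 * m2) ≤ ((Finset.univ.filter fun w => c.Correct w).card : ℝ) := by
  rw [errorProb, div_le_iff₀ hm] at hc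
  have h := Finset.card_filter_add_card_filter_not
    (s := (Finset.univ : Finset (Fin m0 × Fin m1 × Fin m2))) (fun w => c.Correct w)
  rw [Finset.card_univ, Fintype.card_prod, Fintype.card_prod, Fintype.card_fin, Fintype.card_fin,
    Fintype.card_fin] at h
  have h' := congrArg (Nat.cast : ℕ → ℝ) h
  push_cast at h'
  linarith

end BlockCode

/-- A rate that is supported up to a vanishing loss by cuts of capacity `k` is at most `k`. -/
theorem rate_le_of_forall_loss (a : ℝ) (k : ℕ)
    (h : ∀ δ : ℝ, 0 < δ → δ < 1 → ∃ q L : ℕ, 2 ≤ q ∧ 1 ≤ L ∧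
      (1 - δ) * (q : ℝ) ^ ((L : ℝ) * (a - 3 * δ)) ≤ (q : ℝ) ^ (L * k)) : a ≤ k := by
  by_contra! hak
  set ε := (a - k) / 2 with hε
  have hε0 : 0 < ε := by rw [hε]; linarith
  have hr : (1 : ℝ) < 2 ^ ε := Real.one_lt_rpow (by norm_num) hε0
  set r : ℝ := 2 ^ ε with hrdef
  -- the loss is so small that `a - 3 * δ ≥ k + ε` and `(1 - δ) * 2 ^ ε > 1`
  have hrinv : 1 / r < 1 := by rw [div_lt_one (by linarith)]; exact hr
  have hrpos : 0 < 1 / r := by positivity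
  obtain ⟨q, L, hq, hL, hle⟩ := h (min (ε / 3) ((1 - 1 / r) / 2))
    (lt_min (by linarith) (by linarith)) (lt_of_le_of_lt (min_le_right _ _) (by linarith))
  set δ := min (ε / 3) ((1 - 1 / r) / 2)
  have hδ1 : δ ≤ ε / 3 := min_le_left _ _
  have hδ2 : δ ≤ (1 - 1 / r) / 2 := min_le_right _ _
  have hq1 : (1 : ℝ) ≤ q := by exact_mod_cast (by omega : 1 ≤ q)
  have hq2 : (2 : ℝ) ≤ q := by exact_mod_cast hq
  have hL1 : (1 : ℝ) ≤ L := by exact_mod_cast hL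
  have hpow : (q : ℝ) ^ (L * k) * r ≤ (q : ℝ) ^ ((L : ℝ) * (a - 3 * δ)) := by
    calc (q : ℝ) ^ (L * k) * r ≤ (q : ℝ) ^ (L * k) * (q : ℝ) ^ ((L : ℝ) * ε) := by
          refine mul_le_mul_of_nonneg_left ?_ (by positivity)
          calc r ≤ (q : ℝ) ^ ε := Real.rpow_le_rpow (by norm_num) hq2 hε0.le
            _ ≤ (q : ℝ) ^ ((L : ℝ) * ε) := Real.rpow_le_rpow_of_exponent_le hq1 (by nlinarith)
      _ = (q : ℝ) ^ ((L : ℝ) * (k + ε)) := by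
          rw [mul_add, Real.rpow_add (by linarith), ← Real.rpow_natCast]
          push_cast
          rfl
      _ ≤ (q : ℝ) ^ ((L : ℝ) * (a - 3 * δ)) := by
          refine Real.rpow_le_rpow_of_exponent_le hq1 (mul_le_mul_of_nonneg_left ?_ (by linarith))
          linarith
  have h1 : 1 / r < 1 - δ := by linarith
  have h2 : 1 < (1 - δ) * r := by rwa [div_lt_iff₀ (by linarith)] at h1
  have hpos : (0 : ℝ) < (q : ℝ) ^ (L * k) := by positivity
  have h3 : (1 - δ) * ((q : ℝ) ^ (L * k) * r) ≤ (q : ℝ) ^ (L * k) :=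
    (mul_le_mul_of_nonneg_left hpow (by linarith)).trans hle
  nlinarith

theorem Achievable.cutBounds [Fintype E] {N : Network V E} (hT1 : N.S ≠ N.T1) (hT2 : N.S ≠ N.T2)
    {H0 H1 H2 : ℝ} (h : N.Achievable H0 H1 H2) : N.CutBounds H0 H1 H2 := by
  classical
  rw [N.cutBounds_iff hT1 hT2]
  intro C hC
  refine ⟨fun t1 => ?_, fun t2 => ?_, fun t1 t2 => ?_⟩ <;>
    refine rate_le_of_forall_loss _ _ fun δ hδ hδ1 => ?_ <;>
    obtain ⟨q, L, m0, m1, m2, hq, hL, hm0, hm1, hm2, c, hc⟩ := h δ hδ <;>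
    refine ⟨q, L, hq, hL, ?_⟩ <;>
    have hq0 : (0 : ℝ) < q := by exact_mod_cast (by omega : 0 < q)
  all_goals
    have hq1 : (1 : ℝ) ≤ q := by exact_mod_cast (by omega : 1 ≤ q)
    have p0 := Real.rpow_pos_of_pos hq0 ((L : ℝ) * (H0 - δ))
    have p1 := Real.rpow_pos_of_pos hq0 ((L : ℝ) * (H1 - δ))
    have p2 := Real.rpow_pos_of_pos hq0 ((L : ℝ) * (H2 - δ))
    have n0 := p0.trans_le hm0
    have n1 := p1.trans_le hm1
    have n2 := p2.trans_le hm2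
    have hcor := c.le_card_correct hc (by positivity)
    have hLδ : 0 ≤ (L : ℝ) * δ := by positivity
    have hδ' : 0 ≤ 1 - δ := by linarith
  · have hcard := c.card_correct_le C (fun w => w.2.2) (fun w w' hw hw' hcut hg => by
      have h1 : (w.1, w.2.1) = (w'.1, w'.2.1) := by
        rw [← hw.1, ← hw'.1]
        congr 1
        funext e
        exact c.sym_eq_of_cut hC hcut e (by rw [e.2]; exact t1)
      simp only [Prod.mk.injEq] at h1
      exact Prod.ext h1.1 (Prod.ext h1.2 hg))
    rw [Fintype.card_fin, ← @Nat.cast_le ℝ] at hcard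
    push_cast at hcard
    have h1 : (1 - δ) * (m0 * m1) ≤ (q : ℝ) ^ (L * N.cutCapacity C) :=
      le_of_mul_le_mul_right (by linarith) n2
    refine le_trans (mul_le_mul_of_nonneg_left ?_ hδ') h1
    refine le_trans ?_ (mul_le_mul hm0 hm1 p1.le n0.le)
    rw [← Real.rpow_add hq0]
    exact Real.rpow_le_rpow_of_exponent_le hq1 (by linarith)
  · have hcard := c.card_correct_le C (fun w => w.2.1) (fun w w' hw hw' hcut hg => by
      have h1 : (w.1, w.2.2) = (w'.1, w'.2.2) := by
        rw [← hw.2, ← hw'.2]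
        congr 1
        funext e
        exact c.sym_eq_of_cut hC hcut e (by rw [e.2]; exact t2)
      simp only [Prod.mk.injEq] at h1
      exact Prod.ext h1.1 (Prod.ext hg h1.2))
    rw [Fintype.card_fin, ← @Nat.cast_le ℝ] at hcard
    push_cast at hcard
    have h1 : (1 - δ) * (m0 * m2) ≤ (q : ℝ) ^ (L * N.cutCapacity C) :=
      le_of_mul_le_mul_right (by linarith) n1
    refine le_trans (mul_le_mul_of_nonneg_left ?_ hδ') h1
    refine le_trans ?_ (mul_le_mul hm0 hm2 p2.le n0.le)
    rw [← Real.rpow_add hq0]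
    exact Real.rpow_le_rpow_of_exponent_le hq1 (by linarith)
  · have hcard := c.card_correct_le C (fun _ => ()) (fun w w' hw hw' hcut _ => by
      have h1 : (w.1, w.2.1) = (w'.1, w'.2.1) := by
        rw [← hw.1, ← hw'.1]
        congr 1
        funext e
        exact c.sym_eq_of_cut hC hcut e (by rw [e.2]; exact t1)
      have h2 : (w.1, w.2.2) = (w'.1, w'.2.2) := by
        rw [← hw.2, ← hw'.2]
        congr 1
        funext e
        exact c.sym_eq_of_cut hC hcut e (by rw [e.2]; exact t2)
      simp only [Prod.mk.injEq] at h1 h2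
      exact Prod.ext h1.1 (Prod.ext h1.2 h2.2))
    rw [Fintype.card_unit, mul_one, ← @Nat.cast_le ℝ] at hcard
    push_cast at hcard
    refine le_trans (mul_le_mul_of_nonneg_left ?_ hδ') (hcor.trans hcard)
    refine le_trans ?_ (mul_le_mul (mul_le_mul hm0 hm1 p1.le n0.le) hm2 p2.le (by positivity))
    rw [← Real.rpow_add hq0, ← Real.rpow_add hq0]
    exact Real.rpow_le_rpow_of_exponent_le hq1 (by linarith)

/-! ### Block codes from linear codes -/

/-- A linear solution, run for `ℓ` source slots and `D` further slots to clear the delay, is a block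
code without errors. -/
theorem LinearCode.IsSolution.exists_blockCode [Fintype E] {N : Network V E} {F : Type*} [Field F]
    [Finite F] {h0 h1 h2 : ℕ} {c : N.LinearCode F (Streams h0 h1 h2)} (hc : c.IsSolution) :
    ∃ D : ℕ, ∀ ℓ : ℕ, ∃ b : N.BlockCode (Nat.card F) (ℓ + D) (Nat.card F ^ (h0 * ℓ))
      (Nat.card F ^ (h1 * ℓ)) (Nat.card F ^ (h2 * ℓ)), ∀ w, b.Correct w := by
  obtain ⟨D, hX01, hX1, hX02, hX2⟩ := hc
  refine ⟨D, fun ℓ => ?_⟩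
  have hcard : ∀ h : ℕ, Nat.card (Fin h × Fin ℓ → F) = Nat.card F ^ (h * ℓ) := by
    intro h
    simp [Nat.card_fun]
  let enc : ∀ h : ℕ, Fin (Nat.card F ^ (h * ℓ)) ≃ (Fin h × Fin ℓ → F) := fun h =>
    ((finCongr (hcard h).symm).trans (Finite.equivFin _).symm)
  let str : ∀ {h : ℕ}, Fin (Nat.card F ^ (h * ℓ)) → Fin h → ℕ → F := fun {h} a i t =>
    if ht : t < ℓ then enc h a (i, ⟨t, ht⟩) else 0
  have hstr : ∀ {h : ℕ} {a a' : Fin (Nat.card F ^ (h * ℓ))},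
      (∀ i, ∀ t < ℓ, str a i t = str a' i t) → a = a' := by
    intro h a a' haa
    refine (enc h).injective (funext fun ⟨i, t⟩ => ?_)
    simpa [str] using haa i t t.2
  let src : Fin (Nat.card F ^ (h0 * ℓ)) × Fin (Nat.card F ^ (h1 * ℓ)) ×
      Fin (Nat.card F ^ (h2 * ℓ)) → Streams h0 h1 h2 → ℕ → F := fun w =>
    Sum.elim (str w.1) (Sum.elim (str w.2.1) (str w.2.2))
  let alph : F ≃ Fin (Nat.card F) := Finite.equivFin F
  let sym : Fin (Nat.card F ^ (h0 * ℓ)) × Fin (Nat.card F ^ (h1 * ℓ)) ×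
      Fin (Nat.card F ^ (h2 * ℓ)) → E → Fin (ℓ + D) → Fin (Nat.card F) :=
    fun w e t => alph (c.signal (src w) t e)
  have hdec : ∀ {T : V} {m : Streams h0 h1 h2} {w w'}, c.Decodes T D m →
      (fun e : {e // N.tgt e = T} => sym w e.1) = (fun e => sym w' e.1) →
      ∀ t < ℓ, src w m t = src w' m t := by
    intro T m w w' hm hw t ht
    refine hm _ _ t fun e he s hs => alph.injective ?_
    exact congrFun (congrFun hw ⟨e, he⟩) ⟨s, by omega⟩
  have hfac1 : Function.FactorsThrough (fun w => (w.1, w.2.1))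
      (fun w => fun e : {e // N.tgt e = N.T1} => sym w e.1) := fun w w' hw =>
    Prod.ext (hstr fun i t ht => hdec (hX01 i) hw t ht) (hstr fun i t ht => hdec (hX1 i) hw t ht)
  have hfac2 : Function.FactorsThrough (fun w => (w.1, w.2.2))
      (fun w => fun e : {e // N.tgt e = N.T2} => sym w e.1) := fun w w' hw =>
    Prod.ext (hstr fun i t ht => hdec (hX02 i) hw t ht) (hstr fun i t ht => hdec (hX2 i) hw t ht)
  obtain ⟨d1, hd1⟩ : ∃ d : ({e // N.tgt e = N.T1} → Fin (ℓ + D) → Fin (Nat.card F)) →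
      Fin (Nat.card F ^ (h0 * ℓ)) × Fin (Nat.card F ^ (h1 * ℓ)),
      ∀ w, d (fun e => sym w e.1) = (w.1, w.2.1) :=
    ⟨_, hfac1.extend_apply fun _ => ((enc h0).symm 0, (enc h1).symm 0)⟩
  obtain ⟨d2, hd2⟩ : ∃ d : ({e // N.tgt e = N.T2} → Fin (ℓ + D) → Fin (Nat.card F)) →
      Fin (Nat.card F ^ (h0 * ℓ)) × Fin (Nat.card F ^ (h2 * ℓ)),
      ∀ w, d (fun e => sym w e.1) = (w.1, w.2.2) :=
    ⟨_, hfac2.extend_apply fun _ => ((enc h0).symm 0, (enc h2).symm 0)⟩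
  suffices hcausal : ∀ e, N.src e ≠ N.S → ∀ t w w',
      (∀ e', N.tgt e' = N.src e → ∀ s < t, sym w e' s = sym w' e' s) → sym w e t = sym w' e t from
    ⟨⟨sym, hcausal, d1, d2⟩, fun w => ⟨hd1 w, hd2 w⟩⟩
  intro e he t w w' hw
  obtain ⟨t, ht⟩ := t
  cases t with
  | zero => rfl
  | succ t =>
    refine congrArg alph ?_
    simp only [LinearCode.signal, c.inj_eq_zero e _ he, zero_mul, Finset.sum_const_zero, zero_add]
    refine Finset.sum_congr rfl fun e' _ => ?_
    by_cases he' : N.tgt e' = N.src e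
    · congr 1
      exact alph.injective (hw e' he' ⟨t, by omega⟩ (by simp))
    · rw [c.ker_eq_zero e e' he', zero_mul, zero_mul]

theorem BlockCode.errorProb_eq_zero {N : Network V E} {q L m0 m1 m2 : ℕ}
    {c : N.BlockCode q L m0 m1 m2} (h : ∀ w, c.Correct w) : c.errorProb = 0 := by
  simp [errorProb, h]

theorem LinearCode.IsSolution.achievable [Fintype E] {N : Network V E} {F : Type*} [Field F]
    [Finite F] {h0 h1 h2 : ℕ} {c : N.LinearCode F (Streams h0 h1 h2)} (hc : c.IsSolution) :
    N.Achievable h0 h1 h2 := by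
  obtain ⟨D, hD⟩ := hc.exists_blockCode
  intro δ hδ
  obtain ⟨k, hk⟩ := exists_nat_gt ((D * (h0 + h1 + h2) : ℝ) / δ)
  rw [div_lt_iff₀ hδ] at hk
  obtain ⟨b, hb⟩ := hD (k + 1)
  have hq : 1 < Nat.card F := Finite.one_lt_card
  -- the `D` idle slots cost less than the allowed loss in rate
  have hrate : ∀ h : ℕ, h ≤ h0 + h1 + h2 →
      (Nat.card F : ℝ) ^ (((k + 1 + D : ℕ) : ℝ) * (h - δ)) ≤
        ((Nat.card F ^ (h * (k + 1)) : ℕ) : ℝ) := by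
    intro h hh
    rw [Nat.cast_pow, ← Real.rpow_natCast]
    refine Real.rpow_le_rpow_of_exponent_le (by exact_mod_cast hq.le) ?_
    have h3 : (h : ℝ) ≤ h0 + h1 + h2 := by exact_mod_cast hh
    have h4 : (D : ℝ) * h ≤ D * (h0 + h1 + h2) := mul_le_mul_of_nonneg_left h3 D.cast_nonneg
    have h5 : 0 ≤ (D : ℝ) * δ := by positivity
    push_cast
    nlinarith
  exact ⟨Nat.card F, k + 1 + D, _, _, _, hq, by omega, hrate h0 (by omega), hrate h1 (by omega),
    hrate h2 (by omega), b, (BlockCode.errorProb_eq_zero hb).trans_le hδ.le⟩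

/-! ### Changing the time unit -/

/-- The `n` parallel symbols of a code for `N.scale n` form one symbol of an alphabet of size
`q ^ n`. -/
def BlockCode.unscale {N : Network V E} {n q L m0 m1 m2 : ℕ}
    (c : (N.scale n).BlockCode q L m0 m1 m2) : N.BlockCode (q ^ n) L m0 m1 m2 where
  sym w e t := finFunctionFinEquiv fun j => c.sym w (e, j) t
  causal e he t w w' h := by
    congr 1
    funext j
    refine c.causal (e, j) he t w w' fun e' he' s hs => ?_
    exact congrFun (finFunctionFinEquiv.injective (h e'.1 he' s hs)) e'.2
  dec1 y := c.dec1 fun e t => finFunctionFinEquiv.symm (y ⟨e.1.1, e.2⟩ t) e.1.2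
  dec2 y := c.dec2 fun e t => finFunctionFinEquiv.symm (y ⟨e.1.1, e.2⟩ t) e.1.2

theorem BlockCode.errorProb_unscale {N : Network V E} {n q L m0 m1 m2 : ℕ}
    (c : (N.scale n).BlockCode q L m0 m1 m2) : c.unscale.errorProb = c.errorProb := by
  have : ∀ w, c.unscale.Correct w ↔ c.Correct w := fun w => by
    simp only [Correct, unscale, Equiv.symm_apply_apply]
  classical
  rw [errorProb, errorProb]
  congr 2
  exact congrArg Finset.card (Finset.ext fun w => by simp [this])

theorem Achievable.of_scale {N : Network V E} {n : ℕ} (hn : 1 ≤ n) {H0 H1 H2 : ℝ}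
    (h : (N.scale n).Achievable H0 H1 H2) : N.Achievable (H0 / n) (H1 / n) (H2 / n) := by
  intro δ hδ
  obtain ⟨q, L, m0, m1, m2, hq, hL, hm0, hm1, hm2, c, hc⟩ := h δ hδ
  have hn1 : (1 : ℝ) ≤ n := by exact_mod_cast hn
  have hq1 : (1 : ℝ) ≤ q := by exact_mod_cast (by omega : 1 ≤ q)
  have hrate : ∀ H : ℝ, ((q ^ n : ℕ) : ℝ) ^ ((L : ℝ) * (H / n - δ)) ≤
      (q : ℝ) ^ ((L : ℝ) * (H - δ)) := by
    intro H
    rw [Nat.cast_pow, ← Real.rpow_natCast, ← Real.rpow_mul (by linarith)]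
    refine Real.rpow_le_rpow_of_exponent_le hq1 ?_
    have e1 : (n : ℝ) * (L * (H / n - δ)) = L * (H - n * δ) := by field_simp
    rw [e1]
    exact mul_le_mul_of_nonneg_left (by nlinarith) L.cast_nonneg
  exact ⟨q ^ n, L, m0, m1, m2, hq.trans (Nat.le_self_pow (by omega) q), hL, (hrate H0).trans hm0,
    (hrate H1).trans hm1, (hrate H2).trans hm2, c.unscale, (c.errorProb_unscale).trans_le hc⟩

theorem achievable_of_forall_loss {N : Network V E} {H0 H1 H2 : ℝ}
    (h : ∀ ε : ℝ, 0 < ε → ∃ H0' H1' H2' : ℝ, H0 - ε ≤ H0' ∧ H1 - ε ≤ H1' ∧ H2 - ε ≤ H2' ∧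
      N.Achievable H0' H1' H2') : N.Achievable H0 H1 H2 := by
  intro δ hδ
  obtain ⟨H0', H1', H2', h0, h1, h2, hA⟩ := h (δ / 2) (by linarith)
  obtain ⟨q, L, m0, m1, m2, hq, hL, hm0, hm1, hm2, c, hc⟩ := hA (δ / 2) (by linarith)
  have hq1 : (1 : ℝ) ≤ q := by exact_mod_cast (by omega : 1 ≤ q)
  have hrate : ∀ H H' : ℝ, H - δ / 2 ≤ H' →
      (q : ℝ) ^ ((L : ℝ) * (H - δ)) ≤ (q : ℝ) ^ ((L : ℝ) * (H' - δ / 2)) := fun H H' hH =>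
    Real.rpow_le_rpow_of_exponent_le hq1 (mul_le_mul_of_nonneg_left (by linarith) L.cast_nonneg)
  exact ⟨q, L, m0, m1, m2, hq, hL, (hrate _ _ h0).trans hm0, (hrate _ _ h1).trans hm1,
    (hrate _ _ h2).trans hm2, c, hc.trans (by linarith)⟩

theorem CutBounds.achievable [Finite V] [Fintype E] {N : Network V E} (hT1 : N.S ≠ N.T1)
    (hT2 : N.S ≠ N.T2) {H0 H1 H2 : ℝ} (hH0 : 0 ≤ H0) (hH1 : 0 ≤ H1) (hH2 : 0 ≤ H2)
    (h : N.CutBounds H0 H1 H2) : N.Achievable H0 H1 H2 := by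
  refine achievable_of_forall_loss fun ε hε => ?_
  obtain ⟨n, hn⟩ := exists_nat_one_div_lt hε
  obtain ⟨F, _, hfin, -, c, -, hc, -⟩ :=
    (N.scale (n + 1)).exists_routedSolvable hT1 hT2 (h.scale_floor hT1 hT2 hH0 hH1 hH2 (n + 1))
  have hn0 : (0 : ℝ) < (n + 1 : ℕ) := by positivity
  have hloss : ∀ H : ℝ, H - ε ≤ (⌊(n + 1 : ℕ) * H⌋₊ : ℝ) / (n + 1 : ℕ) := by
    intro H
    rw [le_div_iff₀ hn0]
    have h1 := Nat.lt_floor_add_one (((n + 1 : ℕ) : ℝ) * H)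
    rw [div_lt_iff₀ (by positivity)] at hn
    push_cast at h1 ⊢
    nlinarith
  exact ⟨_, _, _, hloss H0, hloss H1, hloss H2, hc.achievable.of_scale (Nat.le_add_left 1 n)⟩

end Network

theorem theorem1 {V E : Type*} [Fintype V] [Fintype E] (N : Network V E)
    (hT1 : N.S ≠ N.T1) (hT2 : N.S ≠ N.T2) :
    -- real rates: the demands can be met if and only if the three inequalities hold
    (∀ H0 H1 H2 : ℝ, 0 ≤ H0 → 0 ≤ H1 → 0 ≤ H2 →
      (N.Achievable H0 H1 H2 ↔ N.CutBounds H0 H1 H2)) ∧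
    -- real rates: routing of `X1`, `X2` and linear coding of `X0`, for every time unit `n`
    (∀ H0 H1 H2 : ℝ, 0 ≤ H0 → 0 ≤ H1 → 0 ≤ H2 → N.CutBounds H0 H1 H2 → ∀ n : ℕ, 1 ≤ n →
      ∃ (F : Type) (_ : Field F), Finite F ∧ CharP F 2 ∧
        (N.scale n).RoutedSolvable F ⌊n * H0⌋₊ ⌊n * H1⌋₊ ⌊n * H2⌋₊) ∧
    -- integer rates: the same on the network itself
    (∀ h0 h1 h2 : ℕ, N.CutBounds h0 h1 h2 →
      ∃ (F : Type) (_ : Field F), Finite F ∧ CharP F 2 ∧ N.RoutedSolvable F h0 h1 h2) ∧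
    -- integer rates: a linear solution over any finite field forces the inequalities
    (∀ h0 h1 h2 : ℕ, ∀ (F : Type) [Field F] [Finite F] (c : N.LinearCode F (Network.Streams h0 h1 h2)),
      c.IsSolution → N.CutBounds h0 h1 h2) := by
  refine ⟨fun H0 H1 H2 hH0 hH1 hH2 => ⟨fun h => h.cutBounds hT1 hT2,
      fun h => h.achievable hT1 hT2 hH0 hH1 hH2⟩,
    fun H0 H1 H2 hH0 hH1 hH2 h n _ => (N.scale n).exists_routedSolvable hT1 hT2
      (h.scale_floor hT1 hT2 hH0 hH1 hH2 n),
    fun h0 h1 h2 h => N.exists_routedSolvable hT1 hT2 h,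
    fun h0 h1 h2 F _ _ c hc => hc.achievable.cutBounds hT1 hT2⟩
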